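/- Setting. Two users, $m\in\{1,2\}$; each transmitter has $L$ antennas and each receiver $K$ antennas. The channel from transmitter $n$ to receiver $m$ is a $K\times L$ random matrix $\mathbf H_{mn}$; all entries of $\mathbf H_{11},\mathbf H_{12},\mathbf H_{21},\mathbf H_{22}$ are i.i.d. $\mathcal{CN}(0,1)$. Let $M\ge 1$ be the number of streams, $M\le N_e$, $M\le N_p$, $N_e=K$, $N_e+N_p\le L$, and let $0<\nu<1$. Each cross channel ($m\ne n$) is decomposed, by a fixed measurable rule, as $\mathbf H_{mn}=\mathbf V_{mn}\boldsymbol\Sigma_{mn}\mathbf U_{mn}^\dagger$ (singular value decomposition, squared singular values $\lambda_{mn}^{[1]}\ge\dots\ge\lambda_{mn}^{[K]}$). With $\mathcal A=\{K-N_e+1,\dots,K\}$ and a fixed $\mathcal B\subset\{1,\dots,L\}$, $|\mathcal B|=N_p$, $\mathcal A\cap\mathcal B=\emptyset$, the inner equalizer $\mathbf G_m$ consists of the columns $\mathcal A$ of $\mathbf V_{mn}$ and the inner precoder $\mathbf F_n$ of the columns $\mathcal B$ of $\mathbf U_{mn}$. The precoder is quantized with finite rate: $\hat{\mathbf F}_n$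 is an element of a fixed finite codebook of $L\times N_p$ matrices with orthonormal columns (the same for both users) that minimizes the error $\epsilon_n=1-\|\mathbf F_n^\dagger\hat{\mathbf F}_n\|_{\mathsf F}^2/N_p$. Let $\lambda_{mm}^{[1]}\ge\lambda_{mm}^{[2]}\ge\cdots$ be the squared singular values of the $N_e\times N_p$ matrix $\mathbf G_m^\dagger\mathbf H_{mm}\hat{\mathbf F}_m$. For a fixed interference margin $\tau>0$ the transmission powers are $$P_n=\min(\eta_n,P_{\max}),\qquad \eta_n=\frac{\tau}{N_p\,\nu\,\lambda_{mn}^{[K-N_e+1]}\,\epsilon_n}\quad(m\neq n),$$ and the achievable throughput is $$A_{\mathsf{IM}}=\sum_{m=1}^2\sum_{\ell=1}^M\mathsf E\left[\log_2\left(1+\frac{\min(\eta_m,P_{\max})\,\lambda_{mm}^{[\ell]}}{1+\tau}\right)\right].$$ Lemma. For every fixed $\tau>0$, as $P_{\max}\to\infty$, $$A_{\mathsf{IM}}=2\sum_{\ell=1}^M\mathsf E\left[\log_2\left(1+\frac{\tau\,\acute\lambda_\ell}{(1+\tau)\,N_p\,\nu\,\check\lambda_{K-N_e+1}\,\epsilon_1}\right)\right]+o(1).$$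 Here $\acute\lambda_\ell$ is the $\ell$-th largest eigenvalue of $\mathbf X^\dagger\mathbf X$ for an $N_e\times N_p$ matrix $\mathbf X$ with i.i.d. $\mathcal{CN}(0,1)$ entries; $\check\lambda_k$ is the $k$-th largest eigenvalue of the $L\times L$ Wishart matrix $\mathbf Y^\dagger\mathbf Y$ with $K$ degrees of freedom, where $\mathbf Y$ is a $K\times L$ matrix with i.i.d. $\mathcal{CN}(0,1)$ entries, independent of $\mathbf X$ (it stands for $\mathbf H_{21}$); and $\epsilon_1$ is the quantization error of the inner precoder computed from $\mathbf Y$. The denominators are almost surely positive and all these expectations are finite. Consequently the throughput saturates as $P_{\max}\to\infty$. The leading term is strictly increasing in $\tau$ and converges to a finite limit as $\tau\to\infty$. If moreover the projection $\mathbf F_1\mathbf F_1^\dagger$ is a fixed measurable function of the projection $\sum_{j>K}\mathbf u_j\mathbf u_j^\dagger$ onto the last $L-K$ right singular vectors of $\mathbf Y$ (which is the null space of $\mathbf Y$ almost surely), then $\check\lambda_{K-N_e+1}$ and $\epsilon_1$ are independent. -/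

import Mathlib

open MeasureTheory ProbabilityTheory Filter Topology Asymptotics
open scoped Matrix

namespace CoopFeedback

/-- Complex matrices carry the product (equivalently, Borel) sigma-algebra of their entries. -/
noncomputable instance instMeasurableSpaceMatrix {m n : ℕ} :
    MeasurableSpace (Matrix (Fin m) (Fin n) ℂ) :=
  inferInstanceAs (MeasurableSpace (Fin m → Fin n → ℂ))

noncomputable section

/-! ### Gaussian matrices and ordered Wishart eigenvalues -/

/-- The circularly symmetric complex Gaussian law `CN(0, 1)`: independent real and imaginary
parts, each centred Gaussian with variance `1 / 2`. -/
def stdCN : Measure ℂ :=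
  ((gaussianReal 0 (1 / 2)).prod (gaussianReal 0 (1 / 2))).map (fun p => (⟨p.1, p.2⟩ : ℂ))

/-- The law of an `m × n` matrix with i.i.d. `CN(0, 1)` entries. -/
def cnMatrix (m n : ℕ) : Measure (Matrix (Fin m) (Fin n) ℂ) :=
  (Measure.pi fun _ : Fin m => Measure.pi fun _ : Fin n => stdCN).map Matrix.of

/-- `gramEig X ℓ` is the `ℓ`-th largest eigenvalue, `1 ≤ ℓ ≤ n` (counted from one, with
multiplicity), of the Hermitian `n × n` matrix `X† X`, i.e. the square of the `ℓ`-th singular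
value of `X` (and zero for `ℓ > n`). If `X` is a Gaussian matrix, `X† X` is a Wishart matrix. -/
def gramEig {m n : ℕ} (X : Matrix (Fin m) (Fin n) ℂ) (ℓ : ℕ) : ℝ :=
  if h : ℓ - 1 < Fintype.card (Fin n) then
    (Matrix.isHermitian_conjTranspose_mul_self X).eigenvalues₀ ⟨ℓ - 1, h⟩
  else 0

/-! ### Singular value decomposition -/

/-- The `K × L` rectangular diagonal matrix with diagonal `s`. -/
def rectDiag {K : ℕ} (L : ℕ) (s : Fin K → ℝ) : Matrix (Fin K) (Fin L) ℂ :=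
  Matrix.of fun i j => if (i : ℕ) = (j : ℕ) then (s i : ℂ) else 0

/-- `X = V Σ U†` is a singular value decomposition of the `K × L` matrix `X`, for `K ≤ L`, with
singular values `s` in descending order. -/
structure IsSVD {K L : ℕ} (X : Matrix (Fin K) (Fin L) ℂ) (V : Matrix (Fin K) (Fin K) ℂ)
    (s : Fin K → ℝ) (U : Matrix (Fin L) (Fin L) ℂ) : Prop where
  left_unitary : V ∈ Matrix.unitaryGroup (Fin K) ℂ
  right_unitary : U ∈ Matrix.unitaryGroup (Fin L) ℂ
  nonneg : ∀ i, 0 ≤ s i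
  antitone : Antitone s
  eq_mul : X = V * rectDiag L s * Uᴴ

/-- A rule by which a node computes a singular value decomposition of a channel matrix. -/
structure SVDRule (K L : ℕ) where
  V : Matrix (Fin K) (Fin L) ℂ → Matrix (Fin K) (Fin K) ℂ
  U : Matrix (Fin K) (Fin L) ℂ → Matrix (Fin L) (Fin L) ℂ
  measurable_V : Measurable V
  measurable_U : Measurable U
  isSVD : ∀ X, ∃ s, IsSVD X (V X) s (U X)

/-! ### Finite-rate quantization of precoders -/

/-- The squared Frobenius norm. -/
def frobSq {m n : ℕ} (X : Matrix (Fin m) (Fin n) ℂ) : ℝ := ∑ i, ∑ j, ‖X i j‖ ^ 2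

/-- The error `1 - ‖F† W‖_F² / N_p` when `W` is used in place of the precoder `F`. -/
def quantErr {L Np : ℕ} (F W : Matrix (Fin L) (Fin Np) ℂ) : ℝ := 1 - frobSq (Fᴴ * W) / Np

/-- A finite-rate quantizer: a codebook of `Q` matrices with orthonormal columns, so that
`log₂ Q` bits are fed back, and a selection rule that minimizes the quantization error. -/
structure Quantizer (L Np Q : ℕ) where
  code : Fin Q → Matrix (Fin L) (Fin Np) ℂ
  orthonormal : ∀ q, (code q)ᴴ * code q = 1
  sel : Matrix (Fin L) (Fin Np) ℂ → Fin Q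
  measurable_sel : Measurable sel
  optimal : ∀ F q, quantErr F (code (sel F)) ≤ quantErr F (code q)

/-! ### Transceiver design -/

/-- The design parameters: antenna numbers `K`, `L`, widths `Ne`, `Np` of the inner equalizers and
precoders, a rule for the singular value decomposition, the column set `𝓑` (the range of `b`) of
the inner precoders, and the quantizer of the inner precoders. The column set of the inner
equalizers is `𝓐 = {K - Ne + 1, …, K}` (counted from one), and `𝓐 ∩ 𝓑 = ∅`. -/
structure Design (K L Ne Np Q : ℕ) where
  Ne_le : Ne ≤ K
  svd : SVDRule K L
  b : Fin Np ↪ Fin L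
  disjoint : ∀ j, ¬ (K - Ne ≤ (b j : ℕ) ∧ (b j : ℕ) < K)
  quantizer : Quantizer L Np Q

namespace Design

variable {K L Ne Np Q : ℕ} (D : Design K L Ne Np Q)

/-- The inner equalizer computed from the cross channel `X` to the receiver: the left singular
vectors for the `Ne` smallest singular values. -/
def innerEq (X : Matrix (Fin K) (Fin L) ℂ) : Matrix (Fin K) (Fin Ne) ℂ :=
  (D.svd.V X).submatrix id
    (fun j => (⟨K - Ne + j, by have := D.Ne_le; have := j.isLt; omega⟩ : Fin K))

/-- The unquantized inner precoder computed from the cross channel `X` from the transmitter. -/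
def innerPre (X : Matrix (Fin K) (Fin L) ℂ) : Matrix (Fin L) (Fin Np) ℂ :=
  (D.svd.U X).submatrix id D.b

/-- The quantized inner precoder. -/
def quantPre (X : Matrix (Fin K) (Fin L) ℂ) : Matrix (Fin L) (Fin Np) ℂ :=
  D.quantizer.code (D.quantizer.sel (D.innerPre X))

/-- The quantization error `ε` of the inner precoder computed from the cross channel `X`. -/
def err (X : Matrix (Fin K) (Fin L) ℂ) : ℝ := quantErr (D.innerPre X) (D.quantPre X)

/-- The orthogonal projection onto the span of the right singular vectors `K + 1, …, L` of `X`;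
this is the null space of `X` whenever `X` has rank `K`. -/
def nullProj (X : Matrix (Fin K) (Fin L) ℂ) : Matrix (Fin L) (Fin L) ℂ :=
  D.svd.U X * Matrix.diagonal (fun j : Fin L => if (j : ℕ) < K then 0 else 1) * (D.svd.U X)ᴴ

/-! In what follows `H m n` is the channel from transmitter `n` to receiver `m`; the other user of
user `m` is `m.rev`. -/

/-- The `Ne × Np` effective data channel of user `m`. Receiver `m` computes its equalizer from
`H m m.rev`, and the precoder of transmitter `m` is fed back by the receiver `m.rev` that it
interferes with. -/
def effChannel (H : Fin 2 → Fin 2 → Matrix (Fin K) (Fin L) ℂ) (m : Fin 2) :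
    Matrix (Fin Ne) (Fin Np) ℂ :=
  (D.innerEq (H m m.rev))ᴴ * H m m * D.quantPre (H m.rev m)

/-- The interference power control signal `η_n`, with margin `τ`. (In the degenerate case of a
zero denominator it should be read as infinite; the theorem asserts that this has probability
zero.) -/
def eta (τ ν : ℝ) (H : Fin 2 → Fin 2 → Matrix (Fin K) (Fin L) ℂ) (n : Fin 2) : ℝ :=
  τ / (Np * ν * gramEig (H n.rev n) (K - Ne + 1) * D.err (H n.rev n))

/-- The transmission power `P_n = min (η_n, P_max)`. -/
def power (τ ν Pmax : ℝ) (H : Fin 2 → Fin 2 → Matrix (Fin K) (Fin L) ℂ) (n : Fin 2) : ℝ :=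
  min (D.eta τ ν H n) Pmax

/-- The rate of the `ℓ`-th stream of user `m` when the interference is as large as the margin. -/
def rate (τ ν Pmax : ℝ) (H : Fin 2 → Fin 2 → Matrix (Fin K) (Fin L) ℂ) (m : Fin 2) (ℓ : ℕ) : ℝ :=
  Real.logb 2 (1 + D.power τ ν Pmax H m * gramEig (D.effChannel H m) ℓ / (1 + τ))

/-- The achievable throughput `A_IM` with `M` streams per user, as a function of `P_max`. -/
def throughput {Ω : Type*} [MeasurableSpace Ω] (P : Measure Ω)
    (H : Fin 2 → Fin 2 → Ω → Matrix (Fin K) (Fin L) ℂ) (M : ℕ) (τ ν Pmax : ℝ) : ℝ :=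
  ∑ m : Fin 2, ∑ ℓ ∈ Finset.Icc 1 M, ∫ ω, D.rate τ ν Pmax (fun i j => H i j ω) m ℓ ∂P

/-- The limiting rate of the `ℓ`-th stream, where `X.1` is an `Ne × Np` data channel and `X.2` a
`K × L` cross channel. -/
def limitRate (τ ν : ℝ) (ℓ : ℕ)
    (X : Matrix (Fin Ne) (Fin Np) ℂ × Matrix (Fin K) (Fin L) ℂ) : ℝ :=
  Real.logb 2 (1 + τ * gramEig X.1 ℓ /
    ((1 + τ) * Np * ν * gramEig X.2 (K - Ne + 1) * D.err X.2))

/-- The leading term of the throughput; the two Gaussian matrices are independent. -/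
def leadingTerm (M : ℕ) (ν τ : ℝ) : ℝ :=
  2 * ∑ ℓ ∈ Finset.Icc 1 M, ∫ X, D.limitRate τ ν ℓ X ∂((cnMatrix Ne Np).prod (cnMatrix K L))

end Design

end

end CoopFeedback

/-! Since `Ne = K`, the inner equalizer is the whole unitary factor `V`, the relevant cross
eigenvalue is the largest one, and disjointness of the two column sets puts the inner precoder `F`
in the null space of its cross channel `X`.

Law of the channels. The equalizer and the quantized precoder depend only on the two cross channels,
which are independent of the data channel. A Gaussian matrix keeps its law under a unitary factor on
the left and orthonormal columns on the right, so the effective channel is Gaussian and independent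
of the cross channel that sets the power (`measurePreserving_effChannel`, `hasLaw_effChannel`). Each
expectation becomes an integral over two independent Gaussian matrices.

Integrability. The danger is a small denominator. As `X * F = 0`, the matrix `X` acts on the
selected codeword `W` only through its component orthogonal to the range of `F`, whose squared norm
is `Np * ε`. Hence `frobSq (X * W) ≤ Np * gramEig X 1 * ε` (`frobSq_mul_le_mul_quantErr`). Every
entry of `X * W_q`, for a fixed codeword `W_q`, is `CN(0,1)`; the codebook is finite, so the
denominator is almost surely positive and its logarithmic singularity is integrable
(`scaledRate_le`, `integrable_scaledRate`).

Limits. For each realization the power cap is eventually inactive, and dominated convergence gives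
the expansion. The margin enters the leading term only through `τ / ((1 + τ) * ν)`, which increases
strictly to `1 / ν`; this gives monotonicity and the finite limit.

Independence. Replacing `X` by `X * W` with `W` unitary keeps the law of `X` and its largest
eigenvalue but conjugates the null projection. Averaging over Haar measure decouples the two
(`lintegral_mul_comp_nullProj`), and the minimal quantization error depends on `F` only through `F *
Fᴴ`. -/

namespace CoopFeedback

/-! ### Comparison of ordered eigenvalues -/

section Symmetric

variable {E : Type*} [NormedAddCommGroup E] [InnerProductSpace ℂ E] {n : ℕ}

lemma norm_sq_eq_sum_repr (b : OrthonormalBasis (Fin n) ℂ E) (x : E) :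
    ‖x‖ ^ 2 = ∑ j, ‖b.repr x j‖ ^ 2 := by
  rw [← b.repr.norm_map x, EuclideanSpace.norm_sq_eq]

variable [FiniteDimensional ℂ E] {S T : E →ₗ[ℂ] E}

lemma re_inner_eq_sum_eigenvalues (hT : T.IsSymmetric) (hn : Module.finrank ℂ E = n) (x : E) :
    (inner ℂ (T x) x).re =
      ∑ j, hT.eigenvalues hn j * ‖(hT.eigenvectorBasis hn).repr x j‖ ^ 2 := by
  rw [← (hT.eigenvectorBasis hn).repr.inner_map_map, PiLp.inner_apply, Complex.re_sum]
  refine Finset.sum_congr rfl fun j _ => ?_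
  rw [hT.eigenvectorBasis_apply_self_apply]
  simp only [RCLike.inner_apply, map_mul, Complex.coe_algebraMap, Complex.conj_ofReal]
  rw [mul_left_comm, Complex.mul_conj, Complex.normSq_eq_norm_sq]
  norm_cast

/-- **Weyl's monotonicity principle** for ordered eigenvalues. -/
lemma eigenvalues_le_eigenvalues_add (hT : T.IsSymmetric) (hS : S.IsSymmetric)
    (hn : Module.finrank ℂ E = n) {δ : ℝ}
    (h : ∀ x, (inner ℂ (T x) x).re ≤ (inner ℂ (S x) x).re + δ * ‖x‖ ^ 2) (i : Fin n) :
    hT.eigenvalues hn i ≤ hS.eigenvalues hn i + δ := by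
  set bT := hT.eigenvectorBasis hn
  set bS := hS.eigenvectorBasis hn
  -- These are `n - 1` linear conditions, so some nonzero `x` satisfies them all. It has no
  -- `S`-components before `i` and no `T`-components after `i`; its two Rayleigh quotients are
  -- therefore bounded by the `i`-th eigenvalues on the sides needed.
  let f : E →ₗ[ℂ] ({j : Fin n // j ≠ i} → ℂ) :=
    { toFun := fun x j => if j.1 < i then bS.repr x j.1 else bT.repr x j.1
      map_add' := fun x y => by ext j; by_cases hj : j.1 < i <;> simp [hj]
      map_smul' := fun c x => by ext j; by_cases hj : j.1 < i <;> simp [hj] }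
  have hker : LinearMap.ker f ≠ ⊥ := by
    apply LinearMap.ker_ne_bot_of_finrank_lt
    have := i.isLt
    simp [hn]
    omega
  obtain ⟨x, hx, hx0⟩ := Submodule.exists_mem_ne_zero_of_ne_bot hker
  have hfx : ∀ j : Fin n, j ≠ i → (if j < i then bS.repr x j else bT.repr x j) = 0 := fun j hj =>
    congrFun (LinearMap.mem_ker.1 hx) ⟨j, hj⟩
  have hpos : 0 < ‖x‖ ^ 2 := by positivity
  have hTx : hT.eigenvalues hn i * ‖x‖ ^ 2 ≤ (inner ℂ (T x) x).re := by
    rw [re_inner_eq_sum_eigenvalues hT hn, norm_sq_eq_sum_repr bT, Finset.mul_sum]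
    refine Finset.sum_le_sum fun j _ => ?_
    rcases lt_or_ge i j with hij | hij
    · have := hfx j hij.ne'
      rw [if_neg (not_lt.2 hij.le)] at this
      simp [bT] at this
      simp [bT, this]
    · exact mul_le_mul_of_nonneg_right (hT.eigenvalues_antitone hn hij) (by positivity)
  have hSx : (inner ℂ (S x) x).re ≤ hS.eigenvalues hn i * ‖x‖ ^ 2 := by
    rw [re_inner_eq_sum_eigenvalues hS hn, norm_sq_eq_sum_repr bS, Finset.mul_sum]
    refine Finset.sum_le_sum fun j _ => ?_
    rcases lt_or_ge j i with hij | hij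
    · have := hfx j hij.ne
      rw [if_pos hij] at this
      simp [bS] at this
      simp [bS, this]
    · exact mul_le_mul_of_nonneg_right (hS.eigenvalues_antitone hn hij) (by positivity)
  have := h x
  nlinarith

end Symmetric

/-! ### The squared singular values of a matrix -/

lemma norm_toLp_sq {m : ℕ} (v : Fin m → ℂ) :
    ‖(WithLp.toLp 2 v : EuclideanSpace ℂ (Fin m))‖ ^ 2 = ∑ i, ‖v i‖ ^ 2 := by
  rw [EuclideanSpace.norm_sq_eq]

lemma inner_toEuclideanLin_eq_dotProduct {n : ℕ} (A : Matrix (Fin n) (Fin n) ℂ)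
    (x : EuclideanSpace ℂ (Fin n)) :
    inner ℂ (Matrix.toEuclideanLin A x) x = star (A *ᵥ x.ofLp) ⬝ᵥ x.ofLp := by
  rw [EuclideanSpace.inner_eq_star_dotProduct, dotProduct_comm]
  rfl

lemma re_inner_gram {m n : ℕ} (X : Matrix (Fin m) (Fin n) ℂ) (x : EuclideanSpace ℂ (Fin n)) :
    (inner ℂ (Matrix.toEuclideanLin (Xᴴ * X) x) x).re = ∑ i, ‖(X *ᵥ x.ofLp) i‖ ^ 2 := by
  rw [inner_toEuclideanLin_eq_dotProduct, ← Matrix.mulVec_mulVec, Matrix.star_mulVec,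
    Matrix.conjTranspose_conjTranspose, ← Matrix.dotProduct_mulVec, dotProduct, Complex.re_sum]
  refine Finset.sum_congr rfl fun i _ => ?_
  rw [← Complex.normSq_eq_norm_sq, Complex.normSq_apply]
  simp

lemma sum_norm_mulVec_le {m n : ℕ} (X : Matrix (Fin m) (Fin n) ℂ) (v : Fin n → ℂ) :
    ∑ i, ‖(X *ᵥ v) i‖ ^ 2 ≤ frobSq X * ∑ j, ‖v j‖ ^ 2 := by
  rw [frobSq, Finset.sum_mul]
  refine Finset.sum_le_sum fun i _ => ?_
  calc ‖(X *ᵥ v) i‖ ^ 2 ≤ (∑ j, ‖X i j‖ * ‖v j‖) ^ 2 := by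
        gcongr
        exact (norm_sum_le Finset.univ fun j => X i j * v j).trans_eq (by simp)
    _ ≤ _ := Finset.sum_mul_sq_le_sq_mul_sq _ _ _

lemma frobSq_nonneg {m n : ℕ} (X : Matrix (Fin m) (Fin n) ℂ) : 0 ≤ frobSq X :=
  Finset.sum_nonneg fun _ _ => Finset.sum_nonneg fun _ _ => by positivity

lemma gramEig_eq_eigenvalues {m n : ℕ} (X : Matrix (Fin m) (Fin n) ℂ) {ℓ : ℕ}
    (h : ℓ - 1 < Fintype.card (Fin n)) :
    gramEig X ℓ = (Matrix.isSymmetric_toEuclideanLin_iff.mpr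
      (Matrix.isHermitian_conjTranspose_mul_self X)).eigenvalues finrank_euclideanSpace
        ⟨ℓ - 1, h⟩ := by
  rw [gramEig, dif_pos h]
  rfl

lemma gramEig_le_gramEig_add {m m' n : ℕ} {X : Matrix (Fin m) (Fin n) ℂ}
    {Y : Matrix (Fin m') (Fin n) ℂ} {δ : ℝ} (hδ : 0 ≤ δ)
    (h : ∀ v : Fin n → ℂ,
      ∑ i, ‖(X *ᵥ v) i‖ ^ 2 ≤ ∑ i, ‖(Y *ᵥ v) i‖ ^ 2 + δ * ∑ j, ‖v j‖ ^ 2) (ℓ : ℕ) :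
    gramEig X ℓ ≤ gramEig Y ℓ + δ := by
  by_cases hℓ : ℓ - 1 < Fintype.card (Fin n)
  · rw [gramEig_eq_eigenvalues X hℓ, gramEig_eq_eigenvalues Y hℓ]
    refine eigenvalues_le_eigenvalues_add _ _ _ (fun x => ?_) _
    rw [re_inner_gram, re_inner_gram, EuclideanSpace.norm_sq_eq]
    exact h x.ofLp
  · rw [gramEig, gramEig, dif_neg hℓ, dif_neg hℓ]
    linarith

lemma exists_gramEig_eq {m n : ℕ} (X : Matrix (Fin m) (Fin n) ℂ) {ℓ : ℕ}
    (h : ℓ - 1 < Fintype.card (Fin n)) :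
    ∃ v : Fin n → ℂ, ∑ j, ‖v j‖ ^ 2 = 1 ∧ gramEig X ℓ = ∑ i, ‖(X *ᵥ v) i‖ ^ 2 := by
  have hT := Matrix.isSymmetric_toEuclideanLin_iff.mpr
    (Matrix.isHermitian_conjTranspose_mul_self X)
  set b := hT.eigenvectorBasis finrank_euclideanSpace with hb
  have hnorm : ‖b ⟨ℓ - 1, h⟩‖ = 1 := b.orthonormal.1 _
  refine ⟨(b ⟨ℓ - 1, h⟩).ofLp, ?_, ?_⟩
  · rw [← EuclideanSpace.norm_sq_eq, hnorm, one_pow]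
  · rw [← re_inner_gram, hb, hT.apply_eigenvectorBasis, inner_smul_left, gramEig_eq_eigenvalues X h,
      inner_self_eq_norm_sq_to_K, ← hb, hnorm]
    simp

lemma gramEig_nonneg {m n : ℕ} (X : Matrix (Fin m) (Fin n) ℂ) (ℓ : ℕ) : 0 ≤ gramEig X ℓ := by
  by_cases hℓ : ℓ - 1 < Fintype.card (Fin n)
  · obtain ⟨v, -, hv⟩ := exists_gramEig_eq X hℓ
    rw [hv]
    positivity
  · rw [gramEig, dif_neg hℓ]

lemma gramEig_le_frobSq {m n : ℕ} (X : Matrix (Fin m) (Fin n) ℂ) (ℓ : ℕ) :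
    gramEig X ℓ ≤ frobSq X := by
  by_cases hℓ : ℓ - 1 < Fintype.card (Fin n)
  · obtain ⟨v, hv, hXv⟩ := exists_gramEig_eq X hℓ
    simpa [hXv, hv] using sum_norm_mulVec_le X v
  · rw [gramEig, dif_neg hℓ]
    exact frobSq_nonneg X

/-- Expanding `v` in an eigenbasis of the Gram matrix bounds every eigenvalue by the first. This is
the operator norm bound behind the estimate of the denominator. -/
lemma sum_norm_mulVec_le_gramEig_one {m n : ℕ} (X : Matrix (Fin m) (Fin n) ℂ) (v : Fin n → ℂ) :
    ∑ i, ‖(X *ᵥ v) i‖ ^ 2 ≤ gramEig X 1 * ∑ j, ‖v j‖ ^ 2 := by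
  rcases Nat.eq_zero_or_pos n with rfl | hn
  · simp [Matrix.mulVec, dotProduct]
  have hℓ : 1 - 1 < Fintype.card (Fin n) := by simpa using hn
  have hT := Matrix.isSymmetric_toEuclideanLin_iff.mpr
    (Matrix.isHermitian_conjTranspose_mul_self X)
  rw [gramEig_eq_eigenvalues X hℓ, ← re_inner_gram X (WithLp.toLp 2 v), ← norm_toLp_sq,
    re_inner_eq_sum_eigenvalues hT finrank_euclideanSpace,
    norm_sq_eq_sum_repr (hT.eigenvectorBasis finrank_euclideanSpace), Finset.mul_sum]
  refine Finset.sum_le_sum fun j _ => mul_le_mul_of_nonneg_right ?_ (by positivity)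
  exact hT.eigenvalues_antitone _ (Fin.le_def.2 (by simp))

lemma gramEig_one_pos {m n : ℕ} {X : Matrix (Fin m) (Fin n) ℂ} {i : Fin m} {j : Fin n}
    (h : X i j ≠ 0) : 0 < gramEig X 1 := by
  have h1 := sum_norm_mulVec_le_gramEig_one X (Pi.single j 1)
  have h2 : ∑ k, ‖(Pi.single j 1 : Fin n → ℂ) k‖ ^ 2 = 1 := by
    rw [Finset.sum_eq_single j] <;> simp +contextual
  rw [h2, mul_one] at h1
  refine lt_of_lt_of_le ?_ h1
  refine Finset.sum_pos' (fun _ _ => by positivity) ⟨i, Finset.mem_univ _, ?_⟩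
  simpa using pow_pos (norm_pos_iff.2 h) 2

/-- The largest squared singular value does not change under right multiplication by a unitary
matrix. -/
lemma gramEig_one_mul_unitary {m n : ℕ} (X : Matrix (Fin m) (Fin n) ℂ)
    {U : Matrix (Fin n) (Fin n) ℂ} (hU : U ∈ Matrix.unitaryGroup (Fin n) ℂ) :
    gramEig (X * U) 1 = gramEig X 1 := by
  have key : ∀ (Y : Matrix (Fin m) (Fin n) ℂ) {W : Matrix (Fin n) (Fin n) ℂ},
      W ∈ Matrix.unitaryGroup (Fin n) ℂ → gramEig (Y * W) 1 ≤ gramEig Y 1 := by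
    intro Y W hW
    by_cases hℓ : 1 - 1 < Fintype.card (Fin n)
    · obtain ⟨v, hv, hYv⟩ := exists_gramEig_eq (Y * W) hℓ
      have h1 := sum_norm_mulVec_le_gramEig_one Y (W *ᵥ v)
      have h2 : ∑ j, ‖(W *ᵥ v) j‖ ^ 2 = ∑ j, ‖v j‖ ^ 2 := by
        have := re_inner_gram W (WithLp.toLp 2 v)
        rw [← Matrix.star_eq_conjTranspose, Matrix.mem_unitaryGroup_iff'.1 hW] at this
        rw [← norm_toLp_sq v, ← this]
        simp [Matrix.toLpLin_one, inner_self_eq_norm_sq_to_K]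
        norm_cast
      rw [h2, hv, mul_one, Matrix.mulVec_mulVec] at h1
      rwa [hYv]
    · rw [gramEig, gramEig, dif_neg hℓ, dif_neg hℓ]
  refine le_antisymm (key X hU) ?_
  -- The reverse inequality is the same bound applied to `X * U` and the inverse of `U`.
  have := key (X * U) (Unitary.star_mem hU)
  rwa [Matrix.mul_assoc, Matrix.mem_unitaryGroup_iff.1 hU, Matrix.mul_one] at this

lemma abs_star_dotProduct_mulVec_le {n : ℕ} (A : Matrix (Fin n) (Fin n) ℂ) (v : Fin n → ℂ) :
    |(star v ⬝ᵥ (A *ᵥ v)).re| ≤ (∑ i, ∑ j, ‖A i j‖) * ∑ j, ‖v j‖ ^ 2 := by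
  have hle : ∀ i, ‖v i‖ ^ 2 ≤ ∑ j, ‖v j‖ ^ 2 := fun i =>
    Finset.single_le_sum (f := fun j => ‖v j‖ ^ 2) (fun _ _ => by positivity) (Finset.mem_univ i)
  refine (Complex.abs_re_le_norm _).trans ?_
  rw [dotProduct, Finset.sum_mul]
  refine (norm_sum_le _ _).trans (Finset.sum_le_sum fun i _ => ?_)
  rw [Matrix.mulVec, dotProduct, Finset.mul_sum, Finset.sum_mul]
  refine (norm_sum_le _ _).trans (Finset.sum_le_sum fun j _ => ?_)
  have : ‖v i‖ * ‖v j‖ ≤ ∑ j, ‖v j‖ ^ 2 := by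
    nlinarith [hle i, hle j, sq_nonneg (‖v i‖ - ‖v j‖)]
  calc ‖star v i * (A i j * v j)‖ = ‖A i j‖ * (‖v i‖ * ‖v j‖) := by
        simp only [norm_mul, Pi.star_apply, norm_star]; ring
    _ ≤ ‖A i j‖ * ∑ j, ‖v j‖ ^ 2 := by gcongr

/-- Weyl's inequality in both directions, with the sum of the entrywise norms of the difference of
the Gram matrices as perturbation bound. Measurability of the ordered eigenvalues follows. -/
lemma continuous_gramEig {m n : ℕ} (ℓ : ℕ) :
    Continuous fun X : Matrix (Fin m) (Fin n) ℂ => gramEig X ℓ := by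
  rw [continuous_iff_continuousAt]
  intro Y
  let d : Matrix (Fin m) (Fin n) ℂ → ℝ := fun X => ∑ i, ∑ j, ‖(Xᴴ * X - Yᴴ * Y) i j‖
  have hd : Tendsto d (𝓝 Y) (𝓝 0) := by
    have : Continuous d := by fun_prop
    simpa [d] using this.tendsto Y
  have hd0 : ∀ X, 0 ≤ d X := fun X => by positivity
  have hform : ∀ (X : Matrix (Fin m) (Fin n) ℂ) (v : Fin n → ℂ),
      |∑ i, ‖(X *ᵥ v) i‖ ^ 2 - ∑ i, ‖(Y *ᵥ v) i‖ ^ 2| ≤ d X * ∑ j, ‖v j‖ ^ 2 := by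
    intro X v
    have h1 : ∀ Z : Matrix (Fin m) (Fin n) ℂ,
        ∑ i, ‖(Z *ᵥ v) i‖ ^ 2 = (star v ⬝ᵥ ((Zᴴ * Z) *ᵥ v)).re := by
      intro Z
      rw [← re_inner_gram Z (WithLp.toLp 2 v), inner_toEuclideanLin_eq_dotProduct, Matrix.star_mulVec,
        ← Matrix.dotProduct_mulVec, (Matrix.isHermitian_conjTranspose_mul_self Z).eq]
    rw [h1, h1, ← Complex.sub_re, ← dotProduct_sub, ← Matrix.sub_mulVec]
    exact abs_star_dotProduct_mulVec_le _ v
  refine tendsto_iff_dist_tendsto_zero.2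
    (squeeze_zero (fun _ => dist_nonneg) (fun X => ?_) hd)
  rw [Real.dist_eq, abs_sub_le_iff]
  constructor
  · have := gramEig_le_gramEig_add (hd0 X) (X := X) (Y := Y)
      (fun v => by linarith [(abs_sub_le_iff.1 (hform X v)).1]) ℓ
    linarith
  · have := gramEig_le_gramEig_add (hd0 X) (X := Y) (Y := X)
      (fun v => by linarith [(abs_sub_le_iff.1 (hform X v)).2]) ℓ
    linarith

/-! ### Gaussian matrices -/

instance instBorelSpaceMatrix {m n : ℕ} : BorelSpace (Matrix (Fin m) (Fin n) ℂ) :=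
  inferInstanceAs (BorelSpace (Fin m → Fin n → ℂ))

instance instSecondCountableTopologyMatrix {m n : ℕ} :
    SecondCountableTopology (Matrix (Fin m) (Fin n) ℂ) :=
  inferInstanceAs (SecondCountableTopology (Fin m → Fin n → ℂ))

lemma measurable_matrix_of {m n : ℕ} :
    Measurable (Matrix.of : (Fin m → Fin n → ℂ) → Matrix (Fin m) (Fin n) ℂ) := measurable_id

lemma measurable_matrix_apply {m n : ℕ} (i : Fin m) (j : Fin n) :
    Measurable fun X : Matrix (Fin m) (Fin n) ℂ => X i j :=
  (measurable_pi_apply j).comp (measurable_pi_apply (X := fun _ => Fin n → ℂ) i)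

section Measurability

variable {α : Type*} [MeasurableSpace α] {m n p : ℕ}

lemma measurable_matrix_iff {f : α → Matrix (Fin m) (Fin n) ℂ} :
    Measurable f ↔ ∀ i j, Measurable fun a => f a i j := by
  refine ⟨fun h i j => (measurable_matrix_apply i j).comp h, fun h => ?_⟩
  exact measurable_pi_lambda (X := fun _ => Fin n → ℂ) f fun i => measurable_pi_lambda _ (h i)

lemma _root_.Measurable.matrix_mul {f : α → Matrix (Fin m) (Fin n) ℂ} {g : α → Matrix (Fin n) (Fin p) ℂ}
    (hf : Measurable f) (hg : Measurable g) : Measurable fun a => f a * g a := by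
  rw [measurable_matrix_iff] at *
  intro i j
  simp only [Matrix.mul_apply]
  exact Finset.measurable_sum _ fun k _ => (hf i k).mul (hg k j)

lemma _root_.Measurable.matrix_transpose {f : α → Matrix (Fin m) (Fin n) ℂ} (hf : Measurable f) :
    Measurable fun a => (f a)ᵀ := by
  rw [measurable_matrix_iff] at *
  exact fun i j => hf j i

lemma _root_.Measurable.matrix_conjTranspose {f : α → Matrix (Fin m) (Fin n) ℂ} (hf : Measurable f) :
    Measurable fun a => (f a)ᴴ := by
  rw [measurable_matrix_iff] at *
  exact fun i j => (continuous_star (R := ℂ)).measurable.comp (hf j i)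

lemma measurable_frobSq : Measurable (frobSq : Matrix (Fin m) (Fin n) ℂ → ℝ) := by
  unfold frobSq
  exact Finset.measurable_sum _ fun i _ => Finset.measurable_sum _ fun j _ =>
    (measurable_matrix_apply i j).norm.pow_const 2

lemma measurable_gramEig (ℓ : ℕ) :
    Measurable fun X : Matrix (Fin m) (Fin n) ℂ => gramEig X ℓ := (continuous_gramEig ℓ).measurable

end Measurability

lemma measurable_complex_mk : Measurable fun p : ℝ × ℝ => (⟨p.1, p.2⟩ : ℂ) :=
  Complex.measurableEquivRealProd.symm.measurable

instance instIsProbabilityMeasureStdCN : IsProbabilityMeasure stdCN :=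
  Measure.isProbabilityMeasure_map measurable_complex_mk.aemeasurable

instance instIsProbabilityMeasureCnMatrix {m n : ℕ} : IsProbabilityMeasure (cnMatrix m n) :=
  Measure.isProbabilityMeasure_map measurable_matrix_of.aemeasurable

/-- Only the modulus of `t` enters, and quadratically in the exponent; this is the source of all the
unitary invariance below. -/
lemma charFun_stdCN (t : ℂ) : charFun stdCN t = Complex.exp (-(‖t‖ ^ 2 / 4 : ℝ)) := by
  have h : ∀ x : ℝ, charFun (gaussianReal 0 (1 / 2)) x = Complex.exp (-(x ^ 2 / 4 : ℝ)) := by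
    intro x
    rw [charFun_gaussianReal]
    congr 1
    push_cast
    ring
  rw [charFun_apply, stdCN, integral_map measurable_complex_mk.aemeasurable
    (by fun_prop : Measurable fun z : ℂ => _).aestronglyMeasurable]
  have h2 : ∀ p : ℝ × ℝ, Complex.exp ((inner ℝ (⟨p.1, p.2⟩ : ℂ) t : ℝ) * Complex.I) =
      Complex.exp ((inner ℝ p.1 t.re : ℝ) * Complex.I) *
        Complex.exp ((inner ℝ p.2 t.im : ℝ) * Complex.I) := by
    intro p
    rw [← Complex.exp_add, ← add_mul]
    congr 2
    simp [Complex.inner]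
  simp_rw [h2]
  rw [integral_prod_mul (μ := gaussianReal 0 (1 / 2)) (ν := gaussianReal 0 (1 / 2))
    (fun x : ℝ => Complex.exp ((inner ℝ x t.re : ℝ) * Complex.I))
    (fun x : ℝ => Complex.exp ((inner ℝ x t.im : ℝ) * Complex.I)), ← charFun_apply,
    ← charFun_apply, h, h, ← Complex.exp_add, ← Complex.normSq_eq_norm_sq, Complex.normSq_apply]
  congr 1
  push_cast
  ring

lemma sum_norm_sq_mulVec_of_isometry {n p : ℕ} {W : Matrix (Fin n) (Fin p) ℂ}
    (hW : Wᴴ * W = 1) (v : Fin p → ℂ) : ∑ i, ‖(W *ᵥ v) i‖ ^ 2 = ∑ j, ‖v j‖ ^ 2 := by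
  have := re_inner_gram W (WithLp.toLp 2 v)
  rw [hW] at this
  rw [← norm_toLp_sq v, ← this]
  simp [Matrix.toLpLin_one, inner_self_eq_norm_sq_to_K]
  norm_cast

lemma pi_stdCN_map_vecMul {n p : ℕ} {W : Matrix (Fin n) (Fin p) ℂ} (hW : Wᴴ * W = 1) :
    (Measure.pi fun _ : Fin n => stdCN).map (fun v => v ᵥ* W) =
      Measure.pi fun _ : Fin p => stdCN := by
  have hmeas : Measurable fun v : Fin n → ℂ => v ᵥ* W :=
    (by fun_prop : Continuous fun v : Fin n → ℂ => v ᵥ* W).measurable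
  have : IsProbabilityMeasure ((Measure.pi fun _ : Fin n => stdCN).map fun v => v ᵥ* W) :=
    Measure.isProbabilityMeasure_map hmeas.aemeasurable
  refine charFun_eq_pi_iff.1 fun t => ?_
  -- The adjoint map moves `W` from the random vector to the frequency; orthonormal columns make it
  -- norm preserving.
  let s : Fin n → ℂ := fun j => ∑ i, star (W j i) * t i
  have hs : ∑ j, ‖s j‖ ^ 2 = ∑ i, ‖t i‖ ^ 2 := by
    have h := sum_norm_sq_mulVec_of_isometry hW (fun i => star (t i))
    simp only [norm_star] at h
    rw [← h]
    refine Finset.sum_congr rfl fun j _ => ?_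
    rw [← norm_star]
    simp [s, Matrix.mulVec, dotProduct]
  rw [charFun_apply, Measure.map_map (by fun_prop) hmeas, integral_map (by fun_prop)
    (Measurable.aestronglyMeasurable (by fun_prop))]
  have h2 : ∀ v : Fin n → ℂ, Complex.exp
      ((inner ℝ ((WithLp.toLp 2 ∘ fun v => v ᵥ* W) v : PiLp 2 fun _ : Fin p => ℂ) t : ℝ)
        * Complex.I) = ∏ j, Complex.exp ((inner ℝ (v j) (s j) : ℝ) * Complex.I) := by
    intro v
    rw [← Complex.exp_sum, ← Finset.sum_mul, ← Complex.ofReal_sum]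
    congr 3
    rw [PiLp.inner_apply]
    simp only [Function.comp, Complex.inner, s, Matrix.vecMul, dotProduct, Finset.mul_sum,
      Finset.sum_mul, map_sum, Complex.re_sum]
    rw [Finset.sum_comm]
    refine Finset.sum_congr rfl fun j _ => Finset.sum_congr rfl fun i _ => ?_
    simp only [map_mul, RCLike.star_def]
    ring_nf
  simp_rw [h2]
  rw [integral_fintype_prod_eq_prod
    (f := fun j (z : ℂ) => Complex.exp ((inner ℝ z (s j) : ℝ) * Complex.I))]
  simp_rw [← charFun_apply, charFun_stdCN]
  rw [← Complex.exp_sum, ← Complex.exp_sum, Finset.sum_neg_distrib, Finset.sum_neg_distrib,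
    ← Complex.ofReal_sum, ← Complex.ofReal_sum, ← Finset.sum_div, ← Finset.sum_div, hs]

lemma cnMatrix_setOf_forall_mem {m n : ℕ} (s : Fin m → Fin n → Set ℂ)
    (hs : ∀ i j, MeasurableSet (s i j)) :
    cnMatrix m n {X | ∀ i j, X i j ∈ s i j} = ∏ i, ∏ j, stdCN (s i j) := by
  have h : MeasurableSet {X : Matrix (Fin m) (Fin n) ℂ | ∀ i j, X i j ∈ s i j} := by
    simp only [Set.ofPred_forall]
    exact MeasurableSet.iInter fun i => MeasurableSet.iInter fun j =>
      measurable_matrix_apply i j (hs i j)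
  rw [cnMatrix, Measure.map_apply measurable_matrix_of h]
  have : Matrix.of ⁻¹' {X : Matrix (Fin m) (Fin n) ℂ | ∀ i j, X i j ∈ s i j} =
      Set.univ.pi fun i => Set.univ.pi fun j => s i j := by
    ext x
    simp
  rw [this, Measure.pi_pi]
  simp_rw [Measure.pi_pi]

lemma cnMatrix_map_flatten {m n : ℕ} :
    (cnMatrix m n).map (fun X (p : Fin m × Fin n) => X p.1 p.2) =
      Measure.pi fun _ : Fin m × Fin n => stdCN := by
  refine (Measure.pi_eq fun s hs => ?_).symm
  rw [Measure.map_apply (measurable_pi_lambda _ fun p => measurable_matrix_apply _ _)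
    (MeasurableSet.univ_pi hs), Fintype.prod_prod_type]
  rw [← cnMatrix_setOf_forall_mem (fun i j => s (i, j)) fun i j => hs (i, j)]
  congr 1
  ext X
  simp

lemma cnMatrix_map_transpose {m n : ℕ} :
    (cnMatrix m n).map Matrix.transpose = cnMatrix n m := by
  have hT : Measurable (Matrix.transpose : Matrix (Fin m) (Fin n) ℂ → _) :=
    Measurable.matrix_transpose measurable_id
  have hflat : Measurable fun (X : Matrix (Fin n) (Fin m) ℂ) (p : Fin n × Fin m) => X p.1 p.2 :=
    measurable_pi_lambda _ fun p => measurable_matrix_apply _ _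
  let g : (Fin n × Fin m → ℂ) → Matrix (Fin n) (Fin m) ℂ := fun x => Matrix.of fun i j => x (i, j)
  have hg : Measurable g := by
    refine measurable_pi_lambda _ fun i => measurable_pi_lambda _ fun j => ?_
    exact measurable_pi_apply (i, j)
  have h1 : ((cnMatrix m n).map Matrix.transpose).map
      (fun X (p : Fin n × Fin m) => X p.1 p.2) = Measure.pi fun _ : Fin n × Fin m => stdCN := by
    rw [Measure.map_map hflat hT]
    refine (Measure.pi_eq fun s hs => ?_).symm
    rw [Measure.map_apply (hflat.comp hT) (MeasurableSet.univ_pi hs), Fintype.prod_prod_type_right]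
    rw [← cnMatrix_setOf_forall_mem (fun i j => s (j, i)) fun i j => hs (j, i)]
    congr 1
    ext X
    simpa using forall_comm
  have h2 := congrArg (Measure.map g) (h1.trans cnMatrix_map_flatten.symm)
  rw [Measure.map_map hg hflat, Measure.map_map hg hflat] at h2
  have h3 : g ∘ (fun (X : Matrix (Fin n) (Fin m) ℂ) (p : Fin n × Fin m) => X p.1 p.2) = id := rfl
  rwa [h3, Measure.map_id, Measure.map_id] at h2

lemma cnMatrix_map_mul_right {m n p : ℕ} {W : Matrix (Fin n) (Fin p) ℂ} (hW : Wᴴ * W = 1) :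
    (cnMatrix m n).map (fun X => X * W) = cnMatrix m p := by
  have hv : Measurable fun v : Fin n → ℂ => v ᵥ* W :=
    (by fun_prop : Continuous fun v : Fin n → ℂ => v ᵥ* W).measurable
  have hX : Measurable fun X : Matrix (Fin m) (Fin n) ℂ => X * W :=
    Measurable.matrix_mul measurable_id measurable_const
  rw [cnMatrix, Measure.map_map hX measurable_matrix_of, cnMatrix, ← pi_stdCN_map_vecMul hW]
  have : IsProbabilityMeasure ((Measure.pi fun _ : Fin n => stdCN).map fun v => v ᵥ* W) :=
    Measure.isProbabilityMeasure_map hv.aemeasurable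
  rw [← Measure.pi_map_pi (fun _ => hv.aemeasurable)]
  exact (Measure.map_map measurable_matrix_of
    (measurable_pi_lambda _ fun i => hv.comp (measurable_pi_apply i))).symm

/-- Transposition preserves the Gaussian law and turns `V` into the right factor `Vᵀ`, which is
again unitary. -/
lemma cnMatrix_map_mul_left {m n : ℕ} {V : Matrix (Fin m) (Fin m) ℂ}
    (hV : V ∈ Matrix.unitaryGroup (Fin m) ℂ) :
    (cnMatrix m n).map (fun X => V * X) = cnMatrix m n := by
  have hVT : (Vᵀ)ᴴ * Vᵀ = 1 := by
    rw [show (Vᵀ)ᴴ = (Vᴴ)ᵀ from rfl, ← Matrix.transpose_mul, ← Matrix.star_eq_conjTranspose,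
      Matrix.mem_unitaryGroup_iff.1 hV, Matrix.transpose_one]
  have hT : ∀ a b : ℕ, Measurable (Matrix.transpose : Matrix (Fin a) (Fin b) ℂ → _) := fun _ _ =>
    Measurable.matrix_transpose measurable_id
  have hR : Measurable fun X : Matrix (Fin n) (Fin m) ℂ => X * Vᵀ :=
    Measurable.matrix_mul measurable_id measurable_const
  calc (cnMatrix m n).map (fun X => V * X)
      = (((cnMatrix m n).map Matrix.transpose).map fun X => X * Vᵀ).map Matrix.transpose := by
        rw [Measure.map_map hR (hT _ _), Measure.map_map (hT _ _) (hR.comp (hT _ _))]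
        congr 1
        ext X : 1
        simp [Matrix.transpose_mul]
    _ = cnMatrix m n := by
        rw [cnMatrix_map_transpose, cnMatrix_map_mul_right hVT, cnMatrix_map_transpose]

/-- The law of a Gaussian matrix is invariant under multiplication by a unitary matrix from the
left and by a matrix with orthonormal columns from the right. -/
lemma cnMatrix_map_mul_mul {m n p : ℕ} {V : Matrix (Fin m) (Fin m) ℂ}
    {W : Matrix (Fin n) (Fin p) ℂ} (hV : V ∈ Matrix.unitaryGroup (Fin m) ℂ) (hW : Wᴴ * W = 1) :
    (cnMatrix m n).map (fun X => V * X * W) = cnMatrix m p := by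
  rw [← cnMatrix_map_mul_right hW]
  nth_rw 2 [← cnMatrix_map_mul_left hV]
  have h1 : Measurable fun X : Matrix (Fin m) (Fin n) ℂ => V * X :=
    Measurable.matrix_mul measurable_const measurable_id
  have h2 : Measurable fun X : Matrix (Fin m) (Fin n) ℂ => X * W :=
    Measurable.matrix_mul measurable_id measurable_const
  exact (Measure.map_map h2 h1).symm

/-! ### The joint law of the channels -/

section Channels

variable {Ω : Type*} [MeasurableSpace Ω] {P : Measure Ω} {K L : ℕ}
  {H : Fin 2 → Fin 2 → Ω → Matrix (Fin K) (Fin L) ℂ}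

lemma aemeasurable_channel
    (hlaw : ∀ m n i j, HasLaw (fun ω => H m n ω i j) stdCN P) (m n : Fin 2) :
    AEMeasurable (H m n) P :=
  aemeasurable_pi_lambda (X := fun _ => Fin L → ℂ) (H m n) fun i =>
    aemeasurable_pi_lambda _ fun j => (hlaw m n i j).aemeasurable

lemma map_channels [IsProbabilityMeasure P]
    (hlaw : ∀ m n i j, HasLaw (fun ω => H m n ω i j) stdCN P)
    (hindep : iIndepFun
      (fun (p : Fin 2 × Fin 2 × Fin K × Fin L) ω => H p.1 p.2.1 ω p.2.2.1 p.2.2.2) P) :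
    P.map (fun ω (p : Fin 2 × Fin 2) => H p.1 p.2 ω) = Measure.pi fun _ => cnMatrix K L := by
  have hflat := (iIndepFun_iff_map_fun_eq_pi_map
    (fun p : Fin 2 × Fin 2 × Fin K × Fin L =>
      (hlaw p.1 p.2.1 p.2.2.1 p.2.2.2).aemeasurable)).1 hindep
  simp_rw [fun p : Fin 2 × Fin 2 × Fin K × Fin L =>
    (hlaw p.1 p.2.1 p.2.2.1 p.2.2.2).map_eq] at hflat
  -- `u` lists all scalar entries and `c` reassembles the blocks, so a law of the blocks is
  -- determined by its image under `u`.
  let u : (Fin 2 × Fin 2 → Matrix (Fin K) (Fin L) ℂ) → (Fin 2 × Fin 2 × Fin K × Fin L → ℂ) :=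
    fun Y q => Y (q.1, q.2.1) q.2.2.1 q.2.2.2
  let c : (Fin 2 × Fin 2 × Fin K × Fin L → ℂ) → (Fin 2 × Fin 2 → Matrix (Fin K) (Fin L) ℂ) :=
    fun x p => Matrix.of fun i j => x (p.1, p.2, i, j)
  have hu : Measurable u := measurable_pi_lambda _ fun q =>
    (measurable_matrix_apply q.2.2.1 q.2.2.2).comp (measurable_pi_apply (q.1, q.2.1))
  have hc : Measurable c := measurable_pi_lambda _ fun p =>
    measurable_matrix_iff.2 fun i j => measurable_pi_apply (p.1, p.2, i, j)
  have hpi : (Measure.pi fun _ : Fin 2 × Fin 2 => cnMatrix K L).map u =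
      Measure.pi fun _ => stdCN := by
    refine (Measure.pi_eq fun s hs => ?_).symm
    have : u ⁻¹' (Set.univ.pi s) = Set.univ.pi fun p : Fin 2 × Fin 2 =>
        {X : Matrix (Fin K) (Fin L) ℂ | ∀ i j, X i j ∈ s (p.1, p.2, i, j)} := by
      ext Y
      simp [u]
    rw [Measure.map_apply hu (MeasurableSet.univ_pi hs), this, Measure.pi_pi]
    simp_rw [cnMatrix_setOf_forall_mem (fun i j => s (_, _, i, j)) fun i j => hs (_, _, i, j),
      Fintype.prod_prod_type]
  rw [← hpi] at hflat
  have h := congrArg (Measure.map c) hflat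
  rw [Measure.map_map hc hu, AEMeasurable.map_map_of_aemeasurable hc.aemeasurable
    (aemeasurable_pi_lambda _ fun p => (hlaw p.1 p.2.1 p.2.2.1 p.2.2.2).aemeasurable)] at h
  exact h.trans Measure.map_id

/-- The two cross channels are grouped together because they fix the equalizer and the precoder that
act on the data channel. -/
lemma map_channel_triple [IsProbabilityMeasure P]
    (hlaw : ∀ m n i j, HasLaw (fun ω => H m n ω i j) stdCN P)
    (hindep : iIndepFun
      (fun (p : Fin 2 × Fin 2 × Fin K × Fin L) ω => H p.1 p.2.1 ω p.2.2.1 p.2.2.2) P)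
    (m : Fin 2) :
    P.map (fun ω => ((H m m.rev ω, H m.rev m ω), H m m ω)) =
      ((cnMatrix K L).prod (cnMatrix K L)).prod (cnMatrix K L) := by
  have hae := aemeasurable_channel hlaw
  have hpi := map_channels hlaw hindep
  have hone : ∀ a b, P.map (H a b) = cnMatrix K L := by
    intro a b
    rw [← (measurePreserving_eval (fun _ : Fin 2 × Fin 2 => cnMatrix K L) (a, b)).map_eq, ← hpi,
      AEMeasurable.map_map_of_aemeasurable (measurable_pi_apply (a, b)).aemeasurable
        (aemeasurable_pi_lambda _ fun p => hae p.1 p.2)]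
    rfl
  have hind : iIndepFun (fun (p : Fin 2 × Fin 2) => H p.1 p.2) P := by
    refine (iIndepFun_iff_map_fun_eq_pi_map fun p : Fin 2 × Fin 2 => hae p.1 p.2).2 ?_
    rw [hpi]
    simp_rw [hone]
  have hm : m ≠ m.rev := by fin_cases m <;> decide
  have h1 := hind.indepFun_prodMk₀ (fun p => hae p.1 p.2) (m, m.rev) (m.rev, m) (m, m)
    (by simp [hm.symm]) (by simp [hm.symm])
  have h2 : IndepFun (H m m.rev) (H m.rev m) P :=
    hind.indepFun (i := (m, m.rev)) (j := (m.rev, m)) (by simp [hm])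
  rw [indepFun_iff_map_prod_eq_prod_map_map ((hae _ _).prodMk (hae _ _)) (hae _ _)] at h1
  rw [indepFun_iff_map_prod_eq_prod_map_map (hae _ _) (hae _ _)] at h2
  simp only [h2, hone] at h1
  exact h1

end Channels

/-! ### Moments -/

lemma measurePreserving_cnMatrix_apply {m n : ℕ} (i : Fin m) (j : Fin n) :
    MeasurePreserving (fun X : Matrix (Fin m) (Fin n) ℂ => X i j) (cnMatrix m n) stdCN := by
  refine ⟨measurable_matrix_apply i j, ?_⟩
  rw [cnMatrix, Measure.map_map (measurable_matrix_apply i j) measurable_matrix_of]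
  exact ((measurePreserving_eval (fun _ : Fin n => stdCN) j).comp
    (measurePreserving_eval (fun _ : Fin m => Measure.pi fun _ : Fin n => stdCN) i)).map_eq

lemma measurePreserving_stdCN_re : MeasurePreserving Complex.re stdCN (gaussianReal 0 (1 / 2)) := by
  refine ⟨Complex.measurable_re, ?_⟩
  rw [stdCN, Measure.map_map Complex.measurable_re measurable_complex_mk]
  exact measurePreserving_fst.map_eq

lemma measurePreserving_stdCN_im : MeasurePreserving Complex.im stdCN (gaussianReal 0 (1 / 2)) := by
  refine ⟨Complex.measurable_im, ?_⟩
  rw [stdCN, Measure.map_map Complex.measurable_im measurable_complex_mk]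
  exact measurePreserving_snd.map_eq

lemma integrable_sq_gaussianReal (v : NNReal) : Integrable (fun x => x ^ 2) (gaussianReal 0 v) :=
  (memLp_id_gaussianReal (μ := 0) (v := v) 2).integrable_sq

lemma integrable_norm_sq_stdCN : Integrable (fun z : ℂ => ‖z‖ ^ 2) stdCN := by
  have h : (fun z : ℂ => ‖z‖ ^ 2) = fun z => z.re ^ 2 + z.im ^ 2 := by
    ext z
    rw [← Complex.normSq_eq_norm_sq, Complex.normSq_apply]
    ring
  rw [h]
  exact (measurePreserving_stdCN_re.integrable_comp_of_integrable
    (integrable_sq_gaussianReal _)).add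
    (measurePreserving_stdCN_im.integrable_comp_of_integrable (integrable_sq_gaussianReal _))

lemma integrable_frobSq (m n : ℕ) : Integrable frobSq (cnMatrix m n) := by
  unfold frobSq
  refine integrable_finsetSum _ fun i _ => integrable_finsetSum _ fun j _ => ?_
  exact (measurePreserving_cnMatrix_apply i j).integrable_comp_of_integrable
    integrable_norm_sq_stdCN

/-- The bounded density transfers integrability of a logarithmic singularity from Lebesgue measure.
-/
lemma gaussianReal_le_smul_volume {v : NNReal} (hv : v ≠ 0) :
    gaussianReal 0 v ≤ ENNReal.ofReal (√(2 * Real.pi * v))⁻¹ • volume := by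
  rw [gaussianReal_of_var_ne_zero _ hv, ← withDensity_const]
  refine withDensity_mono (ae_of_all _ fun x => ENNReal.ofReal_le_ofReal ?_)
  rw [gaussianPDFReal]
  refine mul_le_of_le_one_right (by positivity) (Real.exp_le_one_iff.2 ?_)
  rw [neg_div]
  exact neg_nonpos.2 (by positivity)

lemma integrable_log_one_add_inv_sq_gaussianReal {v : NNReal} (hv : v ≠ 0) :
    Integrable (fun x => Real.log (1 + 1 / x ^ 2)) (gaussianReal 0 v) := by
  have hlog : Integrable ((Set.Icc (-1) 1).indicator fun x => |Real.log x|) (gaussianReal 0 v) := by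
    refine Integrable.mono_measure ?_ (gaussianReal_le_smul_volume hv)
    refine Integrable.smul_measure ?_ ENNReal.ofReal_ne_top
    rw [integrable_indicator_iff measurableSet_Icc]
    exact ((intervalIntegrable_iff_integrableOn_Icc_of_le (by norm_num)).1
      (intervalIntegral.intervalIntegrable_log' (a := -1) (b := 1))).abs
  -- For `x ≠ 0` the integrand is `log (1 + x ^ 2) - 2 * log x`: the first term is at most `x ^ 2`,
  -- and the second is positive only for `|x| < 1`.
  refine Integrable.mono' ((integrable_sq_gaussianReal v).add (hlog.const_mul 2))
    (by fun_prop : Measurable _).aestronglyMeasurable (ae_of_all _ fun x => ?_)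
  have h0 : 0 ≤ Real.log (1 + 1 / x ^ 2) :=
    Real.log_nonneg (le_add_of_nonneg_right (by positivity))
  rw [Real.norm_eq_abs, abs_of_nonneg h0]
  have hind : 0 ≤ (Set.Icc (-1) 1).indicator (fun x => |Real.log x|) x :=
    Set.indicator_nonneg (fun _ _ => abs_nonneg _) _
  simp only [Pi.add_apply]
  rcases eq_or_ne x 0 with rfl | hx
  · simp
  have hx2 : 0 < x ^ 2 := by positivity
  have heq : Real.log (1 + 1 / x ^ 2) = Real.log (1 + x ^ 2) - 2 * Real.log x := by
    rw [show 1 + 1 / x ^ 2 = (1 + x ^ 2) / x ^ 2 by field_simp; ring,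
      Real.log_div (by positivity) (by positivity), Real.log_pow]
    norm_num
  have h1 : Real.log (1 + x ^ 2) ≤ x ^ 2 := by
    have := Real.log_le_sub_one_of_pos (show 0 < 1 + x ^ 2 by positivity)
    linarith
  have h2 : -Real.log x ≤ (Set.Icc (-1) 1).indicator (fun x => |Real.log x|) x := by
    by_cases hxm : x ∈ Set.Icc (-1 : ℝ) 1
    · rw [Set.indicator_of_mem hxm]
      exact neg_le_abs _
    · rw [Set.indicator_of_notMem hxm]
      have : 1 ≤ |x| := by
        by_contra! hlt
        exact hxm ⟨(abs_lt.1 hlt).1.le, (abs_lt.1 hlt).2.le⟩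
      rw [← Real.log_abs]
      linarith [Real.log_nonneg this]
  rw [heq]
  linarith

lemma stdCN_absolutelyContinuous : stdCN ≪ volume := by
  have h := (Complex.volume_preserving_equiv_real_prod.symm).map_eq
  rw [stdCN, ← h]
  have hg := gaussianReal_absolutelyContinuous 0 (v := 1 / 2) (by norm_num)
  exact (hg.prod hg).map Complex.measurableEquivRealProd.symm.measurable

lemma ae_stdCN_re_ne_zero : ∀ᵐ z ∂stdCN, z.re ≠ 0 := by
  have h : ∀ᵐ x ∂gaussianReal 0 (1 / 2), x ≠ 0 :=
    (gaussianReal_absolutelyContinuous 0 (v := 1 / 2) (by norm_num)).ae_le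
      (Measure.ae_ne volume 0)
  exact measurePreserving_stdCN_re.quasiMeasurePreserving.ae h

lemma integrable_log_one_add_inv_norm_sq_stdCN :
    Integrable (fun z : ℂ => Real.log (1 + 1 / ‖z‖ ^ 2)) stdCN := by
  refine Integrable.mono' (measurePreserving_stdCN_re.integrable_comp_of_integrable
    (integrable_log_one_add_inv_sq_gaussianReal (v := 1 / 2) (by norm_num)))
    (by fun_prop : Measurable _).aestronglyMeasurable ?_
  filter_upwards [ae_stdCN_re_ne_zero] with z hz
  have h0 : 0 ≤ Real.log (1 + 1 / ‖z‖ ^ 2) :=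
    Real.log_nonneg (le_add_of_nonneg_right (by positivity))
  rw [Real.norm_eq_abs, abs_of_nonneg h0]
  have hz2 : 0 < z.re ^ 2 := by positivity
  have hle : z.re ^ 2 ≤ ‖z‖ ^ 2 := sq_le_sq.2 (by simpa using Complex.abs_re_le_norm z)
  simp only [Function.comp]
  gcongr

/-! ### Gaussian matrices have full rank -/

lemma pi_absolutelyContinuous {n : ℕ} {α : Fin n → Type*} [∀ i, MeasurableSpace (α i)]
    {μ ν : ∀ i, Measure (α i)} [∀ i, SigmaFinite (μ i)] [∀ i, SigmaFinite (ν i)]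
    (h : ∀ i, μ i ≪ ν i) : Measure.pi μ ≪ Measure.pi ν := by
  induction n with
  | zero => rw [Measure.pi_of_empty, Measure.pi_of_empty]
  | succ n ih =>
    rw [← (measurePreserving_piFinSuccAbove μ 0).symm.map_eq,
      ← (measurePreserving_piFinSuccAbove ν 0).symm.map_eq]
    exact ((h 0).prod (ih fun j => h _)).map (MeasurableEquiv.measurable _)

/-- On each line `y + t • 1` the determinant is the characteristic polynomial of `-y` at `t`, which
has finitely many zeros. Full measure along all parallel lines gives full Lebesgue measure, and the
Gaussian law is absolutely continuous. -/
lemma ae_det_ne_zero (n : ℕ) : ∀ᵐ X ∂cnMatrix n n, X.det ≠ 0 := by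
  have hdet : Measurable fun x : Fin n → Fin n → ℂ => (Matrix.of x).det :=
    (by fun_prop : Continuous fun x : Fin n → Fin n → ℂ => (Matrix.of x).det).measurable
  have hs : MeasurableSet {x : Fin n → Fin n → ℂ | (Matrix.of x).det ≠ 0} :=
    hdet (measurableSet_singleton 0).compl
  have hvol : ∀ᵐ x ∂(volume : Measure (Fin n → Fin n → ℂ)), (Matrix.of x).det ≠ 0 := by
    have : (volume : Measure (Fin n → ℂ)).IsAddHaarMeasure := inferInstance
    have : (volume : Measure (Fin n → Fin n → ℂ)).IsAddHaarMeasure := Measure.pi.isAddHaarMeasure _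
    refine ae_mem_of_ae_add_linearMap_mem
      (LinearMap.toSpanSingleton ℝ (Fin n → Fin n → ℂ) (1 : Matrix (Fin n) (Fin n) ℂ)) volume volume
      hs fun y => ?_
    change ∀ᵐ t : ℝ, (Matrix.of y + t • (1 : Matrix (Fin n) (Fin n) ℂ)).det ≠ 0
    let p := (-(Matrix.of y)).charpoly
    have hp : p ≠ 0 := (Matrix.charpoly_monic _).ne_zero
    have hfin : {t : ℝ | p.eval (t : ℂ) = 0}.Finite := by
      have := (p.roots.toFinset.finite_toSet).preimage Complex.ofReal_injective.injOn
      refine this.subset fun t ht => ?_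
      simpa [hp] using ht
    have hae : ∀ᵐ t : ℝ, t ∉ {t : ℝ | p.eval (t : ℂ) = 0} :=
      measure_eq_zero_iff_ae_notMem.1 (hfin.measure_zero volume)
    filter_upwards [hae] with t ht
    intro h0
    refine ht ?_
    rw [Matrix.eval_charpoly, ← h0]
    congr 1
    ext i j
    simp [Matrix.scalar_apply, Matrix.diagonal_apply, Matrix.one_apply]
    ring
  have hac : (Measure.pi fun _ : Fin n => Measure.pi fun _ : Fin n => stdCN) ≪
      (volume : Measure (Fin n → Fin n → ℂ)) :=
    pi_absolutelyContinuous fun _ => pi_absolutelyContinuous fun _ => stdCN_absolutelyContinuous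
  exact (ae_map_iff (f := Matrix.of) measurable_matrix_of.aemeasurable hs).2 (hac.ae_le hvol)

/-- The first `K` columns form a square Gaussian matrix, almost surely invertible. A right inverse
is the form of full rank used below. -/
lemma ae_exists_mul_eq_one {K L : ℕ} (h : K ≤ L) :
    ∀ᵐ X ∂cnMatrix K L, ∃ Z : Matrix (Fin L) (Fin K) ℂ,
      X * Z = (1 : Matrix (Fin K) (Fin K) ℂ) := by
  let E : Matrix (Fin L) (Fin K) ℂ := (1 : Matrix (Fin L) (Fin L) ℂ).submatrix id (Fin.castLE h)
  have hE : Eᴴ * E = 1 := by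
    ext i j
    simp [E, Matrix.mul_apply, Matrix.one_apply, eq_comm]
  have hpres : MeasurePreserving (fun X : Matrix (Fin K) (Fin L) ℂ => X * E)
      (cnMatrix K L) (cnMatrix K K) :=
    ⟨Measurable.matrix_mul measurable_id measurable_const, cnMatrix_map_mul_right hE⟩
  filter_upwards [hpres.quasiMeasurePreserving.ae (ae_det_ne_zero K)] with X hX
  refine ⟨E * (X * E)⁻¹, ?_⟩
  rw [← Matrix.mul_assoc]
  exact Matrix.mul_nonsing_inv _ (isUnit_iff_ne_zero.2 hX)

/-! ### Haar measure on the unitary group -/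

instance instCompactSpaceUnitaryGroup (n : ℕ) : CompactSpace (Matrix.unitaryGroup (Fin n) ℂ) := by
  have hball : IsCompact (Set.univ.pi fun _ : Fin n => Set.univ.pi fun _ : Fin n =>
      Metric.closedBall (0 : ℂ) 1) :=
    isCompact_univ_pi fun _ => isCompact_univ_pi fun _ => isCompact_closedBall 0 1
  have hc : IsCompact (Matrix.unitaryGroup (Fin n) ℂ : Set (Matrix (Fin n) (Fin n) ℂ)) := by
    refine IsCompact.of_isClosed_subset hball isClosed_unitary fun U hU i _ j _ => ?_
    simpa using entry_norm_bound_of_unitary hU i j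
  exact isCompact_iff_compactSpace.1 hc

/-- The Haar probability measure on the unitary group. -/
noncomputable def unitaryHaar (n : ℕ) : Measure (Matrix.unitaryGroup (Fin n) ℂ) :=
  Measure.haarMeasure ⊤

instance instIsProbabilityMeasureUnitaryHaar (n : ℕ) : IsProbabilityMeasure (unitaryHaar n) :=
  ⟨by simpa [unitaryHaar] using
    Measure.haarMeasure_self (K₀ := (⊤ : TopologicalSpace.PositiveCompacts
      (Matrix.unitaryGroup (Fin n) ℂ)))⟩

instance instIsMulLeftInvariantUnitaryHaar (n : ℕ) : (unitaryHaar n).IsMulLeftInvariant :=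
  Measure.isMulLeftInvariant_haarMeasure _

/-- The Haar average over a unitary orbit depends only on the orbit. -/
lemma lintegral_unitaryHaar_conj {n : ℕ} (k : Matrix (Fin n) (Fin n) ℂ → ENNReal)
    (E : Matrix (Fin n) (Fin n) ℂ) {U : Matrix (Fin n) (Fin n) ℂ}
    (hU : U ∈ Matrix.unitaryGroup (Fin n) ℂ) :
    ∫⁻ Q, k ((Q : Matrix (Fin n) (Fin n) ℂ)ᴴ * (U * E * Uᴴ) * Q) ∂unitaryHaar n =
      ∫⁻ Q, k ((Q : Matrix (Fin n) (Fin n) ℂ)ᴴ * E * Q) ∂unitaryHaar n := by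
  rw [← lintegral_mul_left_eq_self
    (fun Q : Matrix.unitaryGroup (Fin n) ℂ => k ((Q : Matrix (Fin n) (Fin n) ℂ)ᴴ * E * Q))
    (⟨U, hU⟩⁻¹ : Matrix.unitaryGroup (Fin n) ℂ)]
  refine lintegral_congr fun Q => ?_
  congr 1
  have : ((⟨U, hU⟩⁻¹ * Q : Matrix.unitaryGroup (Fin n) ℂ) : Matrix (Fin n) (Fin n) ℂ) =
      Uᴴ * Q := rfl
  rw [this, Matrix.conjTranspose_mul, Matrix.conjTranspose_conjTranspose]
  simp only [Matrix.mul_assoc]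

/-! ### Null spaces and singular value decompositions -/

/-- `R` is the orthogonal projection onto the null space of `X`. -/
structure IsKerProj {K L : ℕ} (X : Matrix (Fin K) (Fin L) ℂ) (R : Matrix (Fin L) (Fin L) ℂ) :
    Prop where
  mul_eq_zero : X * R = 0
  conjTranspose_eq : Rᴴ = R
  mul_eq_self : ∀ Y : Matrix (Fin L) (Fin L) ℂ, X * Y = 0 → R * Y = Y

/-- Each projection fixes the other: `R * S = S` and `S * R = R`; the adjoint of the latter is `R *
S = R`. Uniqueness is needed because an arbitrary SVD rule need not relate its factors at `X` and at
`X * W`. -/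
lemma IsKerProj.unique {K L : ℕ} {X : Matrix (Fin K) (Fin L) ℂ} {R S : Matrix (Fin L) (Fin L) ℂ}
    (hR : IsKerProj X R) (hS : IsKerProj X S) : R = S := by
  rw [← hR.mul_eq_self S hS.mul_eq_zero]
  nth_rw 1 [← hR.conjTranspose_eq, ← hS.mul_eq_self R hR.mul_eq_zero]
  rw [Matrix.conjTranspose_mul, hR.conjTranspose_eq, hS.conjTranspose_eq]

lemma IsKerProj.mul_unitary {K L : ℕ} {X : Matrix (Fin K) (Fin L) ℂ}
    {R Q : Matrix (Fin L) (Fin L) ℂ} (hR : IsKerProj X R)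
    (hQ : Q ∈ Matrix.unitaryGroup (Fin L) ℂ) : IsKerProj (X * Q) (Qᴴ * R * Q) := by
  have h1 : Q * Qᴴ = 1 := Matrix.mem_unitaryGroup_iff.1 hQ
  have h2 : Qᴴ * Q = 1 := Matrix.mem_unitaryGroup_iff'.1 hQ
  refine ⟨?_, ?_, fun Y hY => ?_⟩
  · rw [Matrix.mul_assoc, ← Matrix.mul_assoc Q, ← Matrix.mul_assoc Q, h1, Matrix.one_mul,
      ← Matrix.mul_assoc, hR.mul_eq_zero, Matrix.zero_mul]
  · simp only [Matrix.conjTranspose_mul, Matrix.conjTranspose_conjTranspose, hR.conjTranspose_eq,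
      Matrix.mul_assoc]
  · rw [Matrix.mul_assoc, Matrix.mul_assoc, hR.mul_eq_self (Q * Y) (by rw [← Matrix.mul_assoc, hY]),
      ← Matrix.mul_assoc, h2, Matrix.one_mul]

/-- The coordinate projection onto the basis vectors `K + 1, …, L`. -/
noncomputable def tailProj (K L : ℕ) : Matrix (Fin L) (Fin L) ℂ :=
  Matrix.diagonal fun j : Fin L => if (j : ℕ) < K then 0 else 1

lemma rectDiag_mul_apply {K L p : ℕ} (h : K ≤ L) (s : Fin K → ℝ) (Y : Matrix (Fin L) (Fin p) ℂ)
    (i : Fin K) (j : Fin p) : (rectDiag L s * Y) i j = s i * Y (Fin.castLE h i) j := by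
  rw [Matrix.mul_apply, Finset.sum_eq_single (Fin.castLE h i)]
  · simp [rectDiag]
  · intro k _ hk
    have : (i : ℕ) ≠ k := fun h' => hk (Fin.ext (by simp [h']))
    simp [rectDiag, this]
  · simp

section SVD

variable {K L : ℕ} {X : Matrix (Fin K) (Fin L) ℂ} {V : Matrix (Fin K) (Fin K) ℂ}
  {s : Fin K → ℝ} {U : Matrix (Fin L) (Fin L) ℂ}

lemma IsSVD.mul_right (h : IsSVD X V s U) : X * U = V * rectDiag L s := by
  have h2 : Uᴴ * U = 1 := Matrix.mem_unitaryGroup_iff'.1 h.right_unitary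
  rw [h.eq_mul, Matrix.mul_assoc, h2, Matrix.mul_one]

lemma IsSVD.mul_apply_eq_zero (h : IsSVD X V s U) (i : Fin K) {j : Fin L} (hj : K ≤ j) :
    (X * U) i j = 0 := by
  rw [h.mul_right, Matrix.mul_apply]
  refine Finset.sum_eq_zero fun k _ => ?_
  have : (k : ℕ) ≠ j := by have := k.isLt; omega
  simp [rectDiag, this]

lemma IsSVD.ne_zero (h : IsSVD X V s U) (hKL : K ≤ L) {Z : Matrix (Fin L) (Fin K) ℂ}
    (hZ : X * Z = (1 : Matrix (Fin K) (Fin K) ℂ)) (i : Fin K) : s i ≠ 0 := by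
  intro hi
  have h1 : V * (rectDiag L s * (Uᴴ * Z)) = 1 := by
    rw [← hZ, h.eq_mul]
    simp only [Matrix.mul_assoc]
  have h2 : rectDiag L s * (Uᴴ * Z) * V = 1 := mul_eq_one_comm.1 h1
  have h3 := congrFun (congrFun h2 i) i
  rw [Matrix.mul_assoc, rectDiag_mul_apply hKL, hi] at h3
  simp at h3

end SVD

namespace Design

variable {K L Ne Np Q : ℕ} (D : Design K L Ne Np Q)

lemma unitary_U (X : Matrix (Fin K) (Fin L) ℂ) : D.svd.U X ∈ Matrix.unitaryGroup (Fin L) ℂ :=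
  (D.svd.isSVD X).choose_spec.right_unitary

lemma unitary_V (X : Matrix (Fin K) (Fin L) ℂ) : D.svd.V X ∈ Matrix.unitaryGroup (Fin K) ℂ :=
  (D.svd.isSVD X).choose_spec.left_unitary

lemma nullProj_eq (X : Matrix (Fin K) (Fin L) ℂ) :
    D.nullProj X = D.svd.U X * tailProj K L * (D.svd.U X)ᴴ := rfl

/-- Columns of `X * U` from `K` on vanish. Conversely, if `X * Y = 0`, the nonzero singular values
force the first `K` rows of `Uᴴ * Y` to vanish. -/
lemma isKerProj_nullProj (hKL : K ≤ L) {X : Matrix (Fin K) (Fin L) ℂ}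
    {Z : Matrix (Fin L) (Fin K) ℂ} (hZ : X * Z = (1 : Matrix (Fin K) (Fin K) ℂ)) :
    IsKerProj X (D.nullProj X) := by
  obtain ⟨s, hs⟩ := D.svd.isSVD X
  refine ⟨?_, ?_, fun Y hY => ?_⟩
  · rw [nullProj_eq, ← Matrix.mul_assoc, ← Matrix.mul_assoc]
    suffices h : X * D.svd.U X * tailProj K L = 0 by rw [h, Matrix.zero_mul]
    ext i j
    rw [tailProj, Matrix.mul_diagonal, Matrix.zero_apply]
    split_ifs with hj
    · rw [mul_zero]
    · rw [hs.mul_apply_eq_zero i (not_lt.1 hj), zero_mul]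
  · rw [nullProj_eq, tailProj, Matrix.conjTranspose_mul, Matrix.conjTranspose_mul,
      Matrix.conjTranspose_conjTranspose, Matrix.diagonal_conjTranspose, ← Matrix.mul_assoc]
    congr 3
    ext j
    rw [Pi.star_apply]
    split_ifs <;> simp
  · have hV : (D.svd.V X)ᴴ * D.svd.V X = 1 := Matrix.mem_unitaryGroup_iff'.1 hs.left_unitary
    have hU : D.svd.U X * (D.svd.U X)ᴴ = 1 := Matrix.mem_unitaryGroup_iff.1 hs.right_unitary
    have h0 : rectDiag L s * ((D.svd.U X)ᴴ * Y) = 0 := by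
      have : (D.svd.V X)ᴴ * (X * Y) = 0 := by rw [hY, Matrix.mul_zero]
      nth_rw 2 [hs.eq_mul] at this
      rwa [Matrix.mul_assoc, Matrix.mul_assoc, ← Matrix.mul_assoc (D.svd.V X)ᴴ, hV,
        Matrix.one_mul] at this
    have h1 : tailProj K L * ((D.svd.U X)ᴴ * Y) = (D.svd.U X)ᴴ * Y := by
      ext i j
      rw [tailProj, Matrix.diagonal_mul]
      split_ifs with hi
      · have := congrFun (congrFun h0 ⟨i, hi⟩) j
        rw [rectDiag_mul_apply hKL, Matrix.zero_apply, mul_eq_zero] at this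
        rw [zero_mul]
        exact (this.resolve_left (by exact_mod_cast hs.ne_zero hKL hZ ⟨i, hi⟩)).symm
      · rw [one_mul]
    rw [nullProj_eq, Matrix.mul_assoc, Matrix.mul_assoc, h1, ← Matrix.mul_assoc, hU, Matrix.one_mul]

lemma measurable_nullProj : Measurable D.nullProj :=
  ((D.svd.measurable_U).matrix_mul measurable_const).matrix_mul
    D.svd.measurable_U.matrix_conjTranspose

lemma nullProj_mul_unitary (hKL : K ≤ L) {X : Matrix (Fin K) (Fin L) ℂ}
    {Z : Matrix (Fin L) (Fin K) ℂ} (hZ : X * Z = (1 : Matrix (Fin K) (Fin K) ℂ))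
    {W : Matrix (Fin L) (Fin L) ℂ} (hW : W ∈ Matrix.unitaryGroup (Fin L) ℂ) :
    D.nullProj (X * W) = Wᴴ * D.nullProj X * W := by
  have h1 : W * Wᴴ = 1 := Matrix.mem_unitaryGroup_iff.1 hW
  refine (D.isKerProj_nullProj hKL (Z := Wᴴ * Z) ?_).unique
    ((D.isKerProj_nullProj hKL hZ).mul_unitary hW)
  rw [Matrix.mul_assoc, ← Matrix.mul_assoc W, h1, Matrix.one_mul, hZ]

lemma measurable_conj_nullProj :
    Measurable fun p : Matrix.unitaryGroup (Fin L) ℂ × Matrix (Fin K) (Fin L) ℂ =>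
      (p.1 : Matrix (Fin L) (Fin L) ℂ)ᴴ * D.nullProj p.2 * (p.1 : Matrix (Fin L) (Fin L) ℂ) := by
  have h1 : Measurable fun p : Matrix.unitaryGroup (Fin L) ℂ × Matrix (Fin K) (Fin L) ℂ =>
      (p.1 : Matrix (Fin L) (Fin L) ℂ) := measurable_subtype_coe.comp measurable_fst
  exact (h1.matrix_conjTranspose.matrix_mul (D.measurable_nullProj.comp measurable_snd)).matrix_mul
    h1

lemma lintegral_mul_comp_nullProj_rotate (hKL : K ≤ L) {f : Matrix (Fin K) (Fin L) ℂ → ENNReal}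
    (hf : Measurable f)
    (hinv : ∀ X, ∀ W ∈ Matrix.unitaryGroup (Fin L) ℂ, f (X * W) = f X)
    {k : Matrix (Fin L) (Fin L) ℂ → ENNReal} (hk : Measurable k)
    {W : Matrix (Fin L) (Fin L) ℂ} (hW : W ∈ Matrix.unitaryGroup (Fin L) ℂ) :
    ∫⁻ X, f X * k (D.nullProj X) ∂cnMatrix K L =
      ∫⁻ X, f X * k (Wᴴ * D.nullProj X * W) ∂cnMatrix K L := by
  have hX : Measurable fun X : Matrix (Fin K) (Fin L) ℂ => X * W :=
    measurable_id.matrix_mul measurable_const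
  have hfk : Measurable fun X => f X * k (D.nullProj X) :=
    hf.mul (hk.comp D.measurable_nullProj)
  nth_rw 1 [← cnMatrix_map_mul_right (Matrix.mem_unitaryGroup_iff'.1 hW)]
  rw [lintegral_map hfk hX]
  refine lintegral_congr_ae ?_
  filter_upwards [ae_exists_mul_eq_one hKL] with X hX
  obtain ⟨Z, hZ⟩ := hX
  rw [hinv X W hW, D.nullProj_mul_unitary hKL hZ hW]

/-- For a Gaussian matrix, every unitarily invariant function is independent of the null space. -/
theorem lintegral_mul_comp_nullProj (hKL : K ≤ L) {f : Matrix (Fin K) (Fin L) ℂ → ENNReal}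
    (hf : Measurable f)
    (hinv : ∀ X, ∀ W ∈ Matrix.unitaryGroup (Fin L) ℂ, f (X * W) = f X)
    {k : Matrix (Fin L) (Fin L) ℂ → ENNReal} (hk : Measurable k) :
    ∫⁻ X, f X * k (D.nullProj X) ∂cnMatrix K L =
      (∫⁻ X, f X ∂cnMatrix K L) *
        ∫⁻ W : Matrix.unitaryGroup (Fin L) ℂ,
          k ((W : Matrix (Fin L) (Fin L) ℂ)ᴴ * tailProj K L * W) ∂unitaryHaar L := by
  have hk' : Measurable fun p : Matrix.unitaryGroup (Fin L) ℂ × Matrix (Fin K) (Fin L) ℂ =>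
      k ((p.1 : Matrix (Fin L) (Fin L) ℂ)ᴴ * D.nullProj p.2 * (p.1 : Matrix (Fin L) (Fin L) ℂ)) :=
    hk.comp D.measurable_conj_nullProj
  have hconj : ∀ X : Matrix (Fin K) (Fin L) ℂ,
      ∫⁻ W : Matrix.unitaryGroup (Fin L) ℂ,
        k ((W : Matrix (Fin L) (Fin L) ℂ)ᴴ * D.nullProj X * W) ∂unitaryHaar L =
      ∫⁻ W : Matrix.unitaryGroup (Fin L) ℂ,
        k ((W : Matrix (Fin L) (Fin L) ℂ)ᴴ * tailProj K L * W) ∂unitaryHaar L := fun X =>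
    lintegral_unitaryHaar_conj k _ (D.unitary_U X)
  have hrot := fun W : Matrix.unitaryGroup (Fin L) ℂ =>
    D.lintegral_mul_comp_nullProj_rotate hKL hf hinv hk W.2
  generalize ∫⁻ W : Matrix.unitaryGroup (Fin L) ℂ,
    k ((W : Matrix (Fin L) (Fin L) ℂ)ᴴ * tailProj K L * W) ∂unitaryHaar L = c at hconj ⊢
  generalize hF : (fun p : Matrix.unitaryGroup (Fin L) ℂ × Matrix (Fin K) (Fin L) ℂ =>
    k ((p.1 : Matrix (Fin L) (Fin L) ℂ)ᴴ * D.nullProj p.2 *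
      (p.1 : Matrix (Fin L) (Fin L) ℂ))) = F at hk'
  have hF' : ∀ (W : Matrix.unitaryGroup (Fin L) ℂ) X, k ((W : Matrix (Fin L) (Fin L) ℂ)ᴴ * D.nullProj X *
      (W : Matrix (Fin L) (Fin L) ℂ)) = F (W, X) := fun W X => congrFun hF (W, X)
  simp only [hF'] at hrot hconj
  generalize ∫⁻ X, f X * k (D.nullProj X) ∂cnMatrix K L = a at hrot ⊢
  -- The rotated integral does not depend on `W`, so it equals its Haar average. After the
  -- interchange the inner average is the constant `c`, since all null projections lie on the
  -- unitary orbit of `tailProj K L`.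
  calc a = ∫⁻ _ : Matrix.unitaryGroup (Fin L) ℂ, a ∂unitaryHaar L := by
        rw [lintegral_const, measure_univ, mul_one]
    _ = ∫⁻ W : Matrix.unitaryGroup (Fin L) ℂ, ∫⁻ X, f X * F (W, X) ∂cnMatrix K L
          ∂unitaryHaar L := lintegral_congr hrot
    _ = ∫⁻ X, ∫⁻ W : Matrix.unitaryGroup (Fin L) ℂ, f X * F (W, X) ∂unitaryHaar L
          ∂cnMatrix K L :=
        lintegral_lintegral_swap ((hf.comp measurable_snd).mul hk').aemeasurable
    _ = _ := by
        rw [← lintegral_mul_const _ hf]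
        refine lintegral_congr fun X => ?_
        have hFX : Measurable fun W => F (W, X) := hk'.comp measurable_prodMk_right
        rw [lintegral_const_mul _ hFX, hconj]

lemma indepFun_comp_nullProj (hKL : K ≤ L) {f : Matrix (Fin K) (Fin L) ℂ → ℝ} (hf : Measurable f)
    (hinv : ∀ X, ∀ W ∈ Matrix.unitaryGroup (Fin L) ℂ, f (X * W) = f X)
    {k : Matrix (Fin L) (Fin L) ℂ → ℝ} (hk : Measurable k) :
    IndepFun f (fun X => k (D.nullProj X)) (cnMatrix K L) := by
  rw [indepFun_iff_measure_inter_preimage_eq_mul]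
  intro A B hA hB
  have hkP : Measurable fun X => k (D.nullProj X) := hk.comp D.measurable_nullProj
  have key := fun (A : Set ℝ) (hA : MeasurableSet A) => D.lintegral_mul_comp_nullProj hKL
    (f := fun X => A.indicator 1 (f X)) (k := fun R => B.indicator 1 (k R))
    ((measurable_one.indicator hA).comp hf) (fun X W hW => by simp only [hinv X W hW])
    ((measurable_one.indicator hB).comp hk)
  have hfA : ∀ A : Set ℝ, MeasurableSet A →
      ∫⁻ X, A.indicator 1 (f X) ∂cnMatrix K L = cnMatrix K L (f ⁻¹' A) := fun A hA => by
    rw [← lintegral_indicator_one (hf hA)]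
    rfl
  have hfB : ∫⁻ X, B.indicator 1 (k (D.nullProj X)) ∂cnMatrix K L =
      cnMatrix K L ((fun X => k (D.nullProj X)) ⁻¹' B) := by
    rw [← lintegral_indicator_one (hkP hB)]
    rfl
  have hfAB : ∫⁻ X, A.indicator 1 (f X) * B.indicator 1 (k (D.nullProj X)) ∂cnMatrix K L =
      cnMatrix K L (f ⁻¹' A ∩ (fun X => k (D.nullProj X)) ⁻¹' B) := by
    rw [← lintegral_indicator_one ((hf hA).inter (hkP hB))]
    refine lintegral_congr fun X => ?_
    by_cases h1 : f X ∈ A <;> by_cases h2 : k (D.nullProj X) ∈ B <;> simp [h1, h2]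
  -- A trivial event for `f` identifies the Haar integral as the probability that `k (D.nullProj X)`
  -- lies in `B`.
  have hc := key Set.univ MeasurableSet.univ
  simp only [Set.indicator_univ, Pi.one_apply, one_mul, lintegral_const, measure_univ] at hc
  rw [← hfAB, key A hA, ← hc, hfA A hA, hfB]

end Design

/-! ### The quantization error -/

lemma frobSq_eq_trace {m n : ℕ} (Z : Matrix (Fin m) (Fin n) ℂ) :
    frobSq Z = (Zᴴ * Z).trace.re := by
  rw [frobSq, Finset.sum_comm, Matrix.trace, Complex.re_sum]
  refine Finset.sum_congr rfl fun j _ => ?_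
  rw [Matrix.diag_apply, Matrix.mul_apply, Complex.re_sum]
  refine Finset.sum_congr rfl fun i _ => ?_
  rw [← Complex.normSq_eq_norm_sq, Complex.normSq_apply]
  simp

lemma norm_sq_apply_le_frobSq {m n : ℕ} (Z : Matrix (Fin m) (Fin n) ℂ) (i : Fin m) (j : Fin n) :
    ‖Z i j‖ ^ 2 ≤ frobSq Z :=
  (Finset.single_le_sum (f := fun j => ‖Z i j‖ ^ 2) (fun _ _ => by positivity)
    (Finset.mem_univ j)).trans
  (Finset.single_le_sum (f := fun i => ∑ j, ‖Z i j‖ ^ 2) (fun _ _ => by positivity)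
    (Finset.mem_univ i))

lemma frobSq_mul_le {m n p : ℕ} (X : Matrix (Fin m) (Fin n) ℂ) (Z : Matrix (Fin n) (Fin p) ℂ) :
    frobSq (X * Z) ≤ gramEig X 1 * frobSq Z := by
  rw [frobSq, frobSq, Finset.sum_comm, Finset.sum_comm (γ := Fin n), Finset.mul_sum]
  exact Finset.sum_le_sum fun j _ => sum_norm_mulVec_le_gramEig_one X fun k => Z k j

lemma quantErr_eq_trace {L Np : ℕ} (F W : Matrix (Fin L) (Fin Np) ℂ) :
    quantErr F W = 1 - (Wᴴ * (F * Fᴴ) * W).trace.re / Np := by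
  rw [quantErr, frobSq_eq_trace, Matrix.conjTranspose_mul, Matrix.conjTranspose_conjTranspose]
  simp only [Matrix.mul_assoc]

/-- Pythagoras: `F * Fᴴ` is the projection onto the range of `F`, and `frobSq W = Np`. -/
lemma natCast_mul_quantErr {L Np : ℕ} (hNp : 0 < Np) {F W : Matrix (Fin L) (Fin Np) ℂ}
    (hF : Fᴴ * F = 1) (hW : Wᴴ * W = 1) :
    Np * quantErr F W = frobSq (W - F * (Fᴴ * W)) := by
  have h : (W - F * (Fᴴ * W))ᴴ * (W - F * (Fᴴ * W)) = 1 - Wᴴ * (F * Fᴴ) * W := by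
    have h1 : Fᴴ * (F * (Fᴴ * W)) = Fᴴ * W := by
      rw [← Matrix.mul_assoc, hF, Matrix.one_mul]
    simp only [Matrix.conjTranspose_sub, Matrix.conjTranspose_mul,
      Matrix.conjTranspose_conjTranspose, Matrix.sub_mul, Matrix.mul_sub, hW, Matrix.mul_assoc, h1]
    abel
  rw [frobSq_eq_trace, h, quantErr_eq_trace, Matrix.trace_sub, Matrix.trace_one, Complex.sub_re]
  have : (Np : ℝ) ≠ 0 := by positivity
  simp only [Fintype.card_fin, Complex.natCast_re]
  field_simp

lemma frobSq_mul_le_mul_quantErr {K L Np : ℕ} (hNp : 0 < Np) {X : Matrix (Fin K) (Fin L) ℂ}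
    {F W : Matrix (Fin L) (Fin Np) ℂ} (hF : Fᴴ * F = 1) (hW : Wᴴ * W = 1) (hXF : X * F = 0) :
    frobSq (X * W) ≤ Np * gramEig X 1 * quantErr F W := by
  have h := frobSq_mul_le X (W - F * (Fᴴ * W))
  rw [Matrix.mul_sub, ← Matrix.mul_assoc, hXF, Matrix.zero_mul, sub_zero,
    ← natCast_mul_quantErr hNp hF hW] at h
  linarith

namespace Design

section General

variable {K L Ne Np Q : ℕ} (D : Design K L Ne Np Q)

lemma innerPre_orthonormal (X : Matrix (Fin K) (Fin L) ℂ) :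
    (D.innerPre X)ᴴ * D.innerPre X = 1 := by
  have hU : (D.svd.U X)ᴴ * D.svd.U X = 1 := Matrix.mem_unitaryGroup_iff'.1 (D.unitary_U X)
  ext i j
  have h := congrFun (congrFun hU (D.b i)) (D.b j)
  have h1 : (1 : Matrix (Fin L) (Fin L) ℂ) (D.b i) (D.b j) =
      (1 : Matrix (Fin Np) (Fin Np) ℂ) i j := by simp [Matrix.one_apply]
  exact h.trans h1

lemma measurable_innerPre : Measurable D.innerPre :=
  measurable_matrix_iff.2 fun i j =>
    (measurable_matrix_apply i (D.b j)).comp D.svd.measurable_U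

lemma measurable_quantPre : Measurable D.quantPre :=
  (measurable_from_top (f := D.quantizer.code)).comp
    (D.quantizer.measurable_sel.comp D.measurable_innerPre)

lemma measurable_innerEq : Measurable D.innerEq :=
  measurable_matrix_iff.2 fun i j =>
    (measurable_matrix_apply i (⟨K - Ne + j, by have := D.Ne_le; omega⟩ : Fin K)).comp
      D.svd.measurable_V

lemma measurable_err : Measurable D.err := by
  have h : Measurable fun X => frobSq ((D.innerPre X)ᴴ * D.quantPre X) :=
    measurable_frobSq.comp (D.measurable_innerPre.matrix_conjTranspose.matrix_mul
      D.measurable_quantPre)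
  exact measurable_const.sub (h.div_const _)

lemma err_nonneg (hNp : 0 < Np) (X : Matrix (Fin K) (Fin L) ℂ) : 0 ≤ D.err X := by
  have h := natCast_mul_quantErr hNp (D.innerPre_orthonormal X)
    (D.quantizer.orthonormal (D.quantizer.sel (D.innerPre X)))
  have h1 : 0 ≤ (Np : ℝ) * D.err X := h ▸ frobSq_nonneg _
  exact nonneg_of_mul_nonneg_right h1 (by exact_mod_cast hNp)

/-- The selected index may depend on the choice of basis `F`; the minimum depends only on `F * Fᴴ`.
-/
lemma err_eq_iInf (X : Matrix (Fin K) (Fin L) ℂ) :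
    D.err X = ⨅ q, quantErr (D.innerPre X) (D.quantizer.code q) := by
  have : Nonempty (Fin Q) := ⟨D.quantizer.sel (D.innerPre X)⟩
  exact le_antisymm (le_ciInf fun q => D.quantizer.optimal _ q)
    (ciInf_le (Set.finite_range _).bddBelow (D.quantizer.sel (D.innerPre X)))

/-- The Wishart eigenvalue and the quantization error are independent if the precoder subspace is
a function of the null space of the cross channel. -/
theorem indepFun_gramEig_err (hKL : K ≤ L) {φ : Matrix (Fin L) (Fin L) ℂ → Matrix (Fin L) (Fin L) ℂ}
    (hφ : Measurable φ) (h : ∀ X, D.innerPre X * (D.innerPre X)ᴴ = φ (D.nullProj X)) :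
    IndepFun (fun X => gramEig X 1) D.err (cnMatrix K L) := by
  let k : Matrix (Fin L) (Fin L) ℂ → ℝ := fun R =>
    ⨅ q, (1 - ((D.quantizer.code q)ᴴ * φ R * D.quantizer.code q).trace.re / Np)
  have htr : Measurable fun A : Matrix (Fin Np) (Fin Np) ℂ => A.trace.re :=
    (by fun_prop : Continuous fun A : Matrix (Fin Np) (Fin Np) ℂ => A.trace.re).measurable
  have hk : Measurable k := Measurable.iInf fun q => measurable_const.sub
    ((htr.comp ((measurable_const.matrix_mul hφ).matrix_mul measurable_const)).div_const _)
  have hke : D.err = fun X => k (D.nullProj X) := by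
    ext X
    simp only [k, D.err_eq_iInf X, quantErr_eq_trace, h]
  rw [hke]
  exact D.indepFun_comp_nullProj hKL (measurable_gramEig 1)
    (fun X W hW => gramEig_one_mul_unitary X hW) hk

end General

section FullEqualizer

variable {K L Np Q : ℕ} (D : Design K L K Np Q)

lemma mul_innerPre (X : Matrix (Fin K) (Fin L) ℂ) : X * D.innerPre X = 0 := by
  obtain ⟨s, hs⟩ := D.svd.isSVD X
  ext i j
  have hj : K ≤ (D.b j : ℕ) := by
    have := D.disjoint j
    omega
  exact hs.mul_apply_eq_zero i hj

lemma innerEq_eq (X : Matrix (Fin K) (Fin L) ℂ) : D.innerEq X = D.svd.V X := by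
  ext i j
  simp [innerEq]

lemma frobSq_mul_quantPre_le (hNp : 0 < Np) (X : Matrix (Fin K) (Fin L) ℂ) :
    frobSq (X * D.quantPre X) ≤ Np * gramEig X 1 * D.err X :=
  frobSq_mul_le_mul_quantErr hNp (D.innerPre_orthonormal X) (D.quantizer.orthonormal _)
    (D.mul_innerPre X)

lemma measurePreserving_mul_code_apply (i : Fin K) (j : Fin Np) (q : Fin Q) :
    MeasurePreserving (fun X => (X * D.quantizer.code q) i j) (cnMatrix K L) stdCN := by
  have h : MeasurePreserving (fun X : Matrix (Fin K) (Fin L) ℂ => X * D.quantizer.code q)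
      (cnMatrix K L) (cnMatrix K Np) :=
    ⟨measurable_id.matrix_mul measurable_const,
      cnMatrix_map_mul_right (D.quantizer.orthonormal q)⟩
  exact (measurePreserving_cnMatrix_apply i j).comp h

/-- The selected codeword depends on `X`, so its product with `X` need not be Gaussian; treating all
codewords at once avoids this. -/
lemma ae_forall_mul_code_ne_zero (i : Fin K) (j : Fin Np) :
    ∀ᵐ X ∂cnMatrix K L, ∀ q, (X * D.quantizer.code q) i j ≠ 0 := by
  rw [ae_all_iff]
  intro q
  filter_upwards [(D.measurePreserving_mul_code_apply i j q).quasiMeasurePreserving.ae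
    ae_stdCN_re_ne_zero] with X hX h0
  exact hX (by rw [h0, Complex.zero_re])

lemma ae_gramEig_pos_and_err_pos (hK : 0 < K) (hNp : 0 < Np) :
    ∀ᵐ X ∂cnMatrix K L, 0 < gramEig X 1 ∧ 0 < D.err X := by
  filter_upwards [D.ae_forall_mul_code_ne_zero ⟨0, hK⟩ ⟨0, hNp⟩] with X hX
  have h1 := (norm_sq_apply_le_frobSq (X * D.quantPre X) ⟨0, hK⟩ ⟨0, hNp⟩).trans
    (D.frobSq_mul_quantPre_le hNp X)
  have h2 : 0 < Np * gramEig X 1 * D.err X :=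
    lt_of_lt_of_le (pow_pos (norm_pos_iff.2 (hX _)) 2) h1
  have hg := gramEig_nonneg X 1
  have he := D.err_nonneg hNp X
  constructor
  · exact lt_of_le_of_ne hg fun h => by simp [← h] at h2
  · exact lt_of_le_of_ne he fun h => by simp [← h] at h2

/-! ### Rates -/

/-- The rate of the `ℓ`-th stream when the received power is `c` times the ratio of the channel gain
to the normalized interference gain. -/
noncomputable def scaledRate (c : ℝ) (ℓ : ℕ)
    (X : Matrix (Fin K) (Fin Np) ℂ × Matrix (Fin K) (Fin L) ℂ) : ℝ :=
  Real.logb 2 (1 + c * gramEig X.1 ℓ / (Np * gramEig X.2 1 * D.err X.2))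

/-- The rate of the `ℓ`-th stream under the power constraint `Pmax`. -/
noncomputable def cappedRate (τ ν Pmax : ℝ) (ℓ : ℕ)
    (X : Matrix (Fin K) (Fin Np) ℂ × Matrix (Fin K) (Fin L) ℂ) : ℝ :=
  Real.logb 2 (1 + min (τ / (Np * ν * gramEig X.2 1 * D.err X.2)) Pmax * gramEig X.1 ℓ / (1 + τ))

lemma measurable_gramEig_fst (ℓ : ℕ) : Measurable
    fun X : Matrix (Fin K) (Fin Np) ℂ × Matrix (Fin K) (Fin L) ℂ => gramEig X.1 ℓ :=
  (measurable_gramEig ℓ).comp measurable_fst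

lemma measurable_gramEig_snd (ℓ : ℕ) : Measurable
    fun X : Matrix (Fin K) (Fin Np) ℂ × Matrix (Fin K) (Fin L) ℂ => gramEig X.2 ℓ :=
  (measurable_gramEig ℓ).comp measurable_snd

lemma measurable_err_snd : Measurable
    fun X : Matrix (Fin K) (Fin Np) ℂ × Matrix (Fin K) (Fin L) ℂ => D.err X.2 :=
  D.measurable_err.comp measurable_snd

lemma measurable_scaledRate (c : ℝ) (ℓ : ℕ) : Measurable (D.scaledRate c ℓ) := by
  have h1 := measurable_gramEig_fst (K := K) (Np := Np) (L := L) ℓ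
  have h2 := measurable_gramEig_snd (K := K) (Np := Np) (L := L) 1
  have h3 := D.measurable_err_snd
  unfold scaledRate Real.logb
  fun_prop

lemma measurable_cappedRate (τ ν Pmax : ℝ) (ℓ : ℕ) : Measurable (D.cappedRate τ ν Pmax ℓ) := by
  have h1 := measurable_gramEig_fst (K := K) (Np := Np) (L := L) ℓ
  have h2 := measurable_gramEig_snd (K := K) (Np := Np) (L := L) 1
  have h3 := D.measurable_err_snd
  unfold cappedRate Real.logb
  fun_prop

lemma scaledRate_mono (hNp : 0 < Np) {c d : ℝ} (hc : 0 ≤ c) (hcd : c ≤ d) (ℓ : ℕ)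
    (X : Matrix (Fin K) (Fin Np) ℂ × Matrix (Fin K) (Fin L) ℂ) :
    D.scaledRate c ℓ X ≤ D.scaledRate d ℓ X := by
  have hg := gramEig_nonneg X.1 ℓ
  have hg2 := gramEig_nonneg X.2 1
  have he := D.err_nonneg hNp X.2
  unfold scaledRate
  gcongr
  norm_num

lemma scaledRate_nonneg (hNp : 0 < Np) {c : ℝ} (hc : 0 ≤ c) (ℓ : ℕ)
    (X : Matrix (Fin K) (Fin Np) ℂ × Matrix (Fin K) (Fin L) ℂ) : 0 ≤ D.scaledRate c ℓ X := by
  have hg := gramEig_nonneg X.1 ℓ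
  have hg2 := gramEig_nonneg X.2 1
  have he := D.err_nonneg hNp X.2
  exact Real.logb_nonneg (by norm_num) (le_add_of_nonneg_right (by positivity))

lemma scaledRate_le (hK : 0 < K) (hNp : 0 < Np) {c : ℝ} (hc : 0 ≤ c) (ℓ : ℕ)
    {X : Matrix (Fin K) (Fin Np) ℂ × Matrix (Fin K) (Fin L) ℂ}
    (hX : ∀ q, (X.2 * D.quantizer.code q) ⟨0, hK⟩ ⟨0, hNp⟩ ≠ 0) :
    D.scaledRate c ℓ X ≤ (c * frobSq X.1 + ∑ q, Real.log
      (1 + 1 / ‖(X.2 * D.quantizer.code q) ⟨0, hK⟩ ⟨0, hNp⟩‖ ^ 2)) / Real.log 2 := by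
  set z : Fin Q → ℝ := fun q => ‖(X.2 * D.quantizer.code q) ⟨0, hK⟩ ⟨0, hNp⟩‖ ^ 2 with hz
  have hzpos : ∀ q, 0 < z q := fun q => pow_pos (norm_pos_iff.2 (hX q)) 2
  set q := D.quantizer.sel (D.innerPre X.2)
  have hden : z q ≤ Np * gramEig X.2 1 * D.err X.2 :=
    (norm_sq_apply_le_frobSq (X.2 * D.quantPre X.2) ⟨0, hK⟩ ⟨0, hNp⟩).trans
      (D.frobSq_mul_quantPre_le hNp X.2)
  have hg := gramEig_nonneg X.1 ℓ
  -- Summing over the codebook removes the dependence of the selected index on `X.2`.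
  have hsum : Real.log (1 + 1 / z q) ≤ ∑ q, Real.log (1 + 1 / z q) :=
    Finset.single_le_sum (f := fun q => Real.log (1 + 1 / z q))
      (fun q _ => Real.log_nonneg (le_add_of_nonneg_right (by have := hzpos q; positivity)))
      (Finset.mem_univ q)
  have hzq := hzpos q
  unfold scaledRate Real.logb
  refine div_le_div_of_nonneg_right ?_ (Real.log_nonneg (by norm_num))
  calc Real.log (1 + c * gramEig X.1 ℓ / (Np * gramEig X.2 1 * D.err X.2))
      ≤ Real.log (1 + c * gramEig X.1 ℓ / z q) := by
        have := hzq.trans_le hden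
        gcongr
    -- The elementary bound `1 + a / z ≤ (1 + a) * (1 + 1 / z)` separates the data channel from the
    -- cross channel.
    _ ≤ Real.log ((1 + c * gramEig X.1 ℓ) * (1 + 1 / z q)) := by
        gcongr
        have h1 : 0 ≤ c * gramEig X.1 ℓ := by positivity
        have h2 : 0 ≤ 1 / z q := by positivity
        rw [div_eq_mul_one_div (c * gramEig X.1 ℓ)]
        nlinarith
    _ = Real.log (1 + c * gramEig X.1 ℓ) + Real.log (1 + 1 / z q) :=
        Real.log_mul (by positivity) (by positivity)
    _ ≤ c * frobSq X.1 + ∑ q, Real.log (1 + 1 / z q) := by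
        have h1 := Real.log_le_sub_one_of_pos (show 0 < 1 + c * gramEig X.1 ℓ by positivity)
        have h2 := mul_le_mul_of_nonneg_left (gramEig_le_frobSq X.1 ℓ) hc
        linarith

lemma integrable_scaledRate (hK : 0 < K) (hNp : 0 < Np) {c : ℝ} (hc : 0 ≤ c) (ℓ : ℕ) :
    Integrable (D.scaledRate c ℓ) ((cnMatrix K Np).prod (cnMatrix K L)) := by
  have h1 : Integrable (fun X : Matrix (Fin K) (Fin Np) ℂ × Matrix (Fin K) (Fin L) ℂ =>
      c * frobSq X.1) ((cnMatrix K Np).prod (cnMatrix K L)) :=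
    ((integrable_frobSq K Np).comp_fst _).const_mul c
  have h2 : Integrable (fun X : Matrix (Fin K) (Fin Np) ℂ × Matrix (Fin K) (Fin L) ℂ =>
      ∑ q, Real.log (1 + 1 / ‖(X.2 * D.quantizer.code q) ⟨0, hK⟩ ⟨0, hNp⟩‖ ^ 2))
      ((cnMatrix K Np).prod (cnMatrix K L)) := by
    refine integrable_finsetSum _ fun q _ => ?_
    have h := (D.measurePreserving_mul_code_apply ⟨0, hK⟩ ⟨0, hNp⟩ q).integrable_comp_of_integrable
      integrable_log_one_add_inv_norm_sq_stdCN
    exact h.comp_snd _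
  refine Integrable.mono' ((h1.add h2).div_const (Real.log 2))
    (D.measurable_scaledRate c ℓ).aestronglyMeasurable ?_
  filter_upwards [Measure.quasiMeasurePreserving_snd.ae
    (D.ae_forall_mul_code_ne_zero ⟨0, hK⟩ ⟨0, hNp⟩)] with X hX
  rw [Real.norm_eq_abs, abs_of_nonneg (D.scaledRate_nonneg hNp hc ℓ X)]
  exact D.scaledRate_le hK hNp hc ℓ hX

lemma cappedRate_nonneg (hNp : 0 < Np) {τ ν Pmax : ℝ} (hτ : 0 ≤ τ) (hν : 0 ≤ ν) (hP : 0 ≤ Pmax)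
    (ℓ : ℕ) (X : Matrix (Fin K) (Fin Np) ℂ × Matrix (Fin K) (Fin L) ℂ) :
    0 ≤ D.cappedRate τ ν Pmax ℓ X := by
  have hg := gramEig_nonneg X.1 ℓ
  have hg2 := gramEig_nonneg X.2 1
  have he := D.err_nonneg hNp X.2
  have hmin : 0 ≤ min (τ / (Np * ν * gramEig X.2 1 * D.err X.2)) Pmax :=
    le_min (by positivity) hP
  exact Real.logb_nonneg (by norm_num) (le_add_of_nonneg_right (by positivity))

lemma logb_eta_eq_scaledRate (τ ν : ℝ) (ℓ : ℕ)
    (X : Matrix (Fin K) (Fin Np) ℂ × Matrix (Fin K) (Fin L) ℂ) :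
    Real.logb 2 (1 + τ / (Np * ν * gramEig X.2 1 * D.err X.2) * gramEig X.1 ℓ / (1 + τ)) =
      D.scaledRate (τ / ((1 + τ) * ν)) ℓ X := by
  rw [scaledRate]
  congr 2
  simp only [div_eq_mul_inv, mul_inv]
  ring

lemma cappedRate_le_scaledRate (hNp : 0 < Np) {τ ν Pmax : ℝ} (hτ : 0 ≤ τ) (hν : 0 ≤ ν)
    (hP : 0 ≤ Pmax) (ℓ : ℕ) (X : Matrix (Fin K) (Fin Np) ℂ × Matrix (Fin K) (Fin L) ℂ) :
    D.cappedRate τ ν Pmax ℓ X ≤ D.scaledRate (τ / ((1 + τ) * ν)) ℓ X := by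
  have hg := gramEig_nonneg X.1 ℓ
  have hg2 := gramEig_nonneg X.2 1
  have he := D.err_nonneg hNp X.2
  have hmin : 0 ≤ min (τ / (Np * ν * gramEig X.2 1 * D.err X.2)) Pmax :=
    le_min (by positivity) hP
  rw [← logb_eta_eq_scaledRate, cappedRate]
  gcongr
  · norm_num
  · exact min_le_left _ _

lemma cappedRate_eventuallyEq (τ ν : ℝ) (ℓ : ℕ)
    (X : Matrix (Fin K) (Fin Np) ℂ × Matrix (Fin K) (Fin L) ℂ) :
    (fun Pmax => D.cappedRate τ ν Pmax ℓ X) =ᶠ[atTop]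
      fun _ => D.scaledRate (τ / ((1 + τ) * ν)) ℓ X := by
  filter_upwards [eventually_ge_atTop (τ / (Np * ν * gramEig X.2 1 * D.err X.2))] with Pmax hP
  rw [cappedRate, min_eq_left hP, logb_eta_eq_scaledRate]

lemma integrable_cappedRate (hK : 0 < K) (hNp : 0 < Np) {τ ν Pmax : ℝ} (hτ : 0 ≤ τ) (hν : 0 ≤ ν)
    (hP : 0 ≤ Pmax) (ℓ : ℕ) :
    Integrable (D.cappedRate τ ν Pmax ℓ) ((cnMatrix K Np).prod (cnMatrix K L)) := by
  refine Integrable.mono' (D.integrable_scaledRate hK hNp (c := τ / ((1 + τ) * ν))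
    (by positivity) ℓ) (D.measurable_cappedRate τ ν Pmax ℓ).aestronglyMeasurable
    (ae_of_all _ fun X => ?_)
  rw [Real.norm_eq_abs, abs_of_nonneg (D.cappedRate_nonneg hNp hτ hν hP ℓ X)]
  exact D.cappedRate_le_scaledRate hNp hτ hν hP ℓ X

/-- Without a power constraint the rate is determined by the interference margin. -/
lemma tendsto_integral_cappedRate (hK : 0 < K) (hNp : 0 < Np) {τ ν : ℝ} (hτ : 0 ≤ τ) (hν : 0 ≤ ν)
    (ℓ : ℕ) :
    Tendsto (fun Pmax => ∫ X, D.cappedRate τ ν Pmax ℓ X ∂(cnMatrix K Np).prod (cnMatrix K L)) atTop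
      (𝓝 (∫ X, D.scaledRate (τ / ((1 + τ) * ν)) ℓ X ∂(cnMatrix K Np).prod (cnMatrix K L))) := by
  refine tendsto_integral_filter_of_dominated_convergence
    (D.scaledRate (τ / ((1 + τ) * ν)) ℓ)
    (Eventually.of_forall fun P => (D.measurable_cappedRate τ ν P ℓ).aestronglyMeasurable) ?_
    (D.integrable_scaledRate hK hNp (by positivity) ℓ)
    (ae_of_all _ fun X => (tendsto_congr' (D.cappedRate_eventuallyEq τ ν ℓ X)).2
      tendsto_const_nhds)
  filter_upwards [eventually_ge_atTop 0] with P hP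
  refine ae_of_all _ fun X => ?_
  rw [Real.norm_eq_abs, abs_of_nonneg (D.cappedRate_nonneg hNp hτ hν hP ℓ X)]
  exact D.cappedRate_le_scaledRate hNp hτ hν hP ℓ X

/-- Approaching `d` from within `[0, d]` makes the rate at `d` itself a dominating function. -/
lemma tendsto_integral_scaledRate (hK : 0 < K) (hNp : 0 < Np) (ℓ : ℕ) {d : ℝ} (hd : 0 ≤ d) :
    Tendsto (fun c => ∫ X, D.scaledRate c ℓ X ∂(cnMatrix K Np).prod (cnMatrix K L)) (𝓝[Set.Icc 0 d] d)
      (𝓝 (∫ X, D.scaledRate d ℓ X ∂(cnMatrix K Np).prod (cnMatrix K L))) := by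
  refine tendsto_integral_filter_of_dominated_convergence (D.scaledRate d ℓ)
    (Eventually.of_forall fun c => (D.measurable_scaledRate c ℓ).aestronglyMeasurable) ?_
    (D.integrable_scaledRate hK hNp hd ℓ) (ae_of_all _ fun X => ?_)
  · filter_upwards [self_mem_nhdsWithin] with c hc
    refine ae_of_all _ fun X => ?_
    rw [Real.norm_eq_abs, abs_of_nonneg (D.scaledRate_nonneg hNp hc.1 ℓ X)]
    exact D.scaledRate_mono hNp hc.1 hc.2 ℓ X
  · have hg := gramEig_nonneg X.1 ℓ
    have hg2 := gramEig_nonneg X.2 1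
    have he := D.err_nonneg hNp X.2
    have hcont : ContinuousAt (fun c => D.scaledRate c ℓ X) d := by
      unfold scaledRate Real.logb
      have : 1 + d * gramEig X.1 ℓ / (Np * gramEig X.2 1 * D.err X.2) ≠ 0 := by positivity
      fun_prop (disch := assumption)
    exact hcont.tendsto.mono_left nhdsWithin_le_nhds

lemma integral_scaledRate_mono (hK : 0 < K) (hNp : 0 < Np) {c d : ℝ} (hc : 0 ≤ c) (hcd : c ≤ d)
    (ℓ : ℕ) : ∫ X, D.scaledRate c ℓ X ∂(cnMatrix K Np).prod (cnMatrix K L) ≤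
      ∫ X, D.scaledRate d ℓ X ∂(cnMatrix K Np).prod (cnMatrix K L) :=
  integral_mono (D.integrable_scaledRate hK hNp hc ℓ)
    (D.integrable_scaledRate hK hNp (hc.trans hcd) ℓ) (D.scaledRate_mono hNp hc hcd ℓ)

lemma integral_scaledRate_one_lt (hK : 0 < K) (hNp : 0 < Np) {c d : ℝ} (hc : 0 ≤ c) (hcd : c < d) :
    ∫ X, D.scaledRate c 1 X ∂(cnMatrix K Np).prod (cnMatrix K L) <
      ∫ X, D.scaledRate d 1 X ∂(cnMatrix K Np).prod (cnMatrix K L) := by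
  have hX1 : ∀ᵐ X ∂cnMatrix K Np, 0 < gramEig X 1 := by
    filter_upwards [(measurePreserving_cnMatrix_apply (n := Np) ⟨0, hK⟩
      ⟨0, hNp⟩).quasiMeasurePreserving.ae ae_stdCN_re_ne_zero] with X hX
    exact gramEig_one_pos fun h0 => hX (by rw [h0, Complex.zero_re])
  have hlt : ∀ᵐ X ∂(cnMatrix K Np).prod (cnMatrix K L),
      D.scaledRate c 1 X < D.scaledRate d 1 X := by
    filter_upwards [Measure.quasiMeasurePreserving_fst.ae hX1,
      Measure.quasiMeasurePreserving_snd.ae (D.ae_gramEig_pos_and_err_pos hK hNp)] with X h1 h2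
    obtain ⟨h2, h3⟩ := h2
    unfold scaledRate
    refine Real.logb_lt_logb (by norm_num) (by positivity) ?_
    gcongr
  -- Equal integrals of almost surely ordered functions would force almost sure equality, against
  -- the strict pointwise inequality.
  refine lt_of_le_of_ne (D.integral_scaledRate_mono hK hNp hc hcd.le 1) fun heq => ?_
  have hae := (integral_eq_iff_of_ae_le (D.integrable_scaledRate hK hNp hc 1)
    (D.integrable_scaledRate hK hNp (hc.trans hcd.le) 1) (hlt.mono fun _ h => h.le)).1 heq
  obtain ⟨X, hX⟩ := (hlt.and hae).exists
  exact hX.1.ne hX.2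

end FullEqualizer

end Design

/-! ### Transport of the throughput to the Gaussian laws -/

lemma _root_.ProbabilityTheory.HasLaw.comp_measurePreserving {Ω α β : Type*} [MeasurableSpace Ω]
    [MeasurableSpace α] [MeasurableSpace β] {P : Measure Ω} {μ : Measure α} {ν : Measure β}
    {T : Ω → α} {Y : Ω → β} {f : α → β} (hT : HasLaw T μ P) (hf : MeasurePreserving f μ ν)
    (hY : ∀ ω, Y ω = f (T ω)) : HasLaw Y ν P := by
  obtain rfl : Y = f ∘ T := funext hY
  refine ⟨hf.measurable.comp_aemeasurable hT.aemeasurable, ?_⟩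
  rw [← AEMeasurable.map_map_of_aemeasurable hf.measurable.aemeasurable hT.aemeasurable, hT.map_eq,
    hf.map_eq]

namespace Design

section Throughput

variable {K L Np Q : ℕ} (D : Design K L K Np Q)

/-- For fixed cross channels the map on the data channel preserves the Gaussian law, which is the
same for every choice of them. The skew product theorem turns this into independence, and the
equalizer's cross channel is forgotten. -/
lemma measurePreserving_effChannel :
    MeasurePreserving
      (fun q : (Matrix (Fin K) (Fin L) ℂ × Matrix (Fin K) (Fin L) ℂ) × Matrix (Fin K) (Fin L) ℂ =>
        ((D.innerEq q.1.1)ᴴ * q.2 * D.quantPre q.1.2, q.1.2))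
      (((cnMatrix K L).prod (cnMatrix K L)).prod (cnMatrix K L))
      ((cnMatrix K Np).prod (cnMatrix K L)) := by
  have hmeas : Measurable fun
      q : (Matrix (Fin K) (Fin L) ℂ × Matrix (Fin K) (Fin L) ℂ) × Matrix (Fin K) (Fin L) ℂ =>
        (D.innerEq q.1.1)ᴴ * q.2 * D.quantPre q.1.2 :=
    ((D.measurable_innerEq.comp (measurable_fst.comp measurable_fst)).matrix_conjTranspose.matrix_mul
      measurable_snd).matrix_mul (D.measurable_quantPre.comp (measurable_snd.comp measurable_fst))
  have hskew := MeasurePreserving.skew_product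
    (μc := cnMatrix K L) (μd := cnMatrix K Np)
    (g := fun p X => (D.innerEq p.1)ᴴ * X * D.quantPre p.2)
    (measurePreserving_snd (μ := cnMatrix K L) (ν := cnMatrix K L)) hmeas
    (ae_of_all _ fun p => by
      rw [innerEq_eq]
      exact cnMatrix_map_mul_mul (Unitary.star_mem (D.unitary_V p.1))
        (D.quantizer.orthonormal _))
  exact Measure.measurePreserving_swap.comp hskew

variable {Ω : Type*} [MeasurableSpace Ω] {P : Measure Ω} [IsProbabilityMeasure P]
  {H : Fin 2 → Fin 2 → Ω → Matrix (Fin K) (Fin L) ℂ}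

/-- The effective data channel is a Gaussian matrix, independent of the cross channel that
determines the transmission power. -/
lemma hasLaw_effChannel
    (hlaw : ∀ m n i j, HasLaw (fun ω => H m n ω i j) stdCN P)
    (hindep : iIndepFun
      (fun (p : Fin 2 × Fin 2 × Fin K × Fin L) ω => H p.1 p.2.1 ω p.2.2.1 p.2.2.2) P)
    (m : Fin 2) :
    HasLaw (fun ω => (D.effChannel (fun i j => H i j ω) m, H m.rev m ω))
      ((cnMatrix K Np).prod (cnMatrix K L)) P := by
  have hae := aemeasurable_channel hlaw
  have htriple : HasLaw (fun ω => ((H m m.rev ω, H m.rev m ω), H m m ω))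
      (((cnMatrix K L).prod (cnMatrix K L)).prod (cnMatrix K L)) P :=
    ⟨((hae _ _).prodMk (hae _ _)).prodMk (hae _ _), map_channel_triple hlaw hindep m⟩
  exact htriple.comp_measurePreserving D.measurePreserving_effChannel fun ω => rfl

lemma rate_eq_cappedRate (τ ν Pmax : ℝ) (H : Fin 2 → Fin 2 → Matrix (Fin K) (Fin L) ℂ)
    (m : Fin 2) (ℓ : ℕ) :
    D.rate τ ν Pmax H m ℓ = D.cappedRate τ ν Pmax ℓ (D.effChannel H m, H m.rev m) := by
  simp only [rate, power, eta, cappedRate, Nat.sub_self, zero_add]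

lemma limitRate_eq_scaledRate (τ ν : ℝ) (ℓ : ℕ) :
    D.limitRate τ ν ℓ = D.scaledRate (τ / ((1 + τ) * ν)) ℓ := by
  ext X
  simp only [limitRate, scaledRate, Nat.sub_self, zero_add]
  congr 2
  simp only [div_eq_mul_inv, mul_inv]
  ring

lemma leadingTerm_eq (M : ℕ) (ν τ : ℝ) :
    D.leadingTerm M ν τ = 2 * ∑ ℓ ∈ Finset.Icc 1 M,
      ∫ X, D.scaledRate (τ / ((1 + τ) * ν)) ℓ X ∂(cnMatrix K Np).prod (cnMatrix K L) := by
  simp only [leadingTerm, limitRate_eq_scaledRate]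

/-- Both users see the same joint law, whence the factor two. -/
lemma throughput_eq
    (hlaw : ∀ m n i j, HasLaw (fun ω => H m n ω i j) stdCN P)
    (hindep : iIndepFun
      (fun (p : Fin 2 × Fin 2 × Fin K × Fin L) ω => H p.1 p.2.1 ω p.2.2.1 p.2.2.2) P)
    (M : ℕ) (τ ν Pmax : ℝ) :
    D.throughput P H M τ ν Pmax = 2 * ∑ ℓ ∈ Finset.Icc 1 M,
      ∫ X, D.cappedRate τ ν Pmax ℓ X ∂(cnMatrix K Np).prod (cnMatrix K L) := by
  have h : ∀ (m : Fin 2) (ℓ : ℕ), ∫ ω, D.rate τ ν Pmax (fun i j => H i j ω) m ℓ ∂P =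
      ∫ X, D.cappedRate τ ν Pmax ℓ X ∂(cnMatrix K Np).prod (cnMatrix K L) := by
    intro m ℓ
    have hl := D.hasLaw_effChannel hlaw hindep m
    simp only [rate_eq_cappedRate]
    rw [← hl.map_eq, integral_map hl.aemeasurable
      (D.measurable_cappedRate τ ν Pmax ℓ).aestronglyMeasurable]
  simp only [throughput, h, Finset.sum_const, Finset.card_univ, Fintype.card_fin, nsmul_eq_mul,
    Nat.cast_ofNat]

end Throughput

/-! ### Dependence on the interference margin -/

lemma div_one_add_mul_lt {ν τ σ : ℝ} (hν : 0 < ν) (hτ : 0 < τ) (h : τ < σ) :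
    τ / ((1 + τ) * ν) < σ / ((1 + σ) * ν) := by
  have hσ : 0 < σ := hτ.trans h
  rw [div_lt_div_iff₀ (by positivity) (by positivity)]
  nlinarith

lemma tendsto_div_one_add_mul {ν : ℝ} (hν : 0 < ν) :
    Tendsto (fun τ : ℝ => τ / ((1 + τ) * ν)) atTop (𝓝[Set.Icc 0 (1 / ν)] (1 / ν)) := by
  refine tendsto_nhdsWithin_iff.2 ⟨?_, ?_⟩
  · have h1 : Tendsto (fun τ : ℝ => (1 - (1 + τ)⁻¹) / ν) atTop (𝓝 ((1 - 0) / ν)) :=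
      ((tendsto_const_nhds).sub (tendsto_inv_atTop_zero.comp
        (tendsto_atTop_add_const_left _ 1 tendsto_id))).div_const ν
    rw [sub_zero] at h1
    refine h1.congr' ?_
    filter_upwards [eventually_gt_atTop 0] with τ hτ
    have : 1 + τ ≠ 0 := by positivity
    field_simp
    ring
  · filter_upwards [eventually_gt_atTop 0] with τ hτ
    refine ⟨by positivity, ?_⟩
    rw [div_le_div_iff₀ (by positivity) hν]
    nlinarith

end Design

end CoopFeedback

/-! ### Saturation of the throughput -/

theorem lemma2 {Ω : Type*} [MeasurableSpace Ω] (P : Measure Ω) [IsProbabilityMeasure P]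
    {K L Ne Np Q M : ℕ}
    (hM : 1 ≤ M) (hMe : M ≤ Ne) (hMp : M ≤ Np) (hK : K = Ne) (hL : Ne + Np ≤ L)
    (ν : ℝ) (hν0 : 0 < ν) (hν1 : ν < 1)
    (D : CoopFeedback.Design K L Ne Np Q)
    (H : Fin 2 → Fin 2 → Ω → Matrix (Fin K) (Fin L) ℂ)
    (hlaw : ∀ m n i j, HasLaw (fun ω => H m n ω i j) CoopFeedback.stdCN P)
    (hindep : iIndepFun
      (fun (p : Fin 2 × Fin 2 × Fin K × Fin L) ω => H p.1 p.2.1 ω p.2.2.1 p.2.2.2) P) :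
    -- the denominators are almost surely positive
    (∀ᵐ ω ∂P, ∀ n : Fin 2, 0 < CoopFeedback.gramEig (H n.rev n ω) (K - Ne + 1) ∧
      0 < D.err (H n.rev n ω)) ∧
    -- the throughput expansion, in which all expectations are finite
    (∀ τ : ℝ, 0 < τ →
      (∀ Pmax : ℝ, 0 < Pmax → ∀ m : Fin 2, ∀ ℓ ∈ Finset.Icc 1 M,
        Integrable (fun ω => D.rate τ ν Pmax (fun i j => H i j ω) m ℓ) P) ∧
      (∀ ℓ ∈ Finset.Icc 1 M, Integrable (D.limitRate τ ν ℓ)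
        ((CoopFeedback.cnMatrix Ne Np).prod (CoopFeedback.cnMatrix K L))) ∧
      (fun Pmax : ℝ => D.throughput P H M τ ν Pmax - D.leadingTerm M ν τ)
        =o[atTop] (fun _ => (1 : ℝ))) ∧
    -- the leading term increases in the margin and has a finite limit
    StrictMonoOn (D.leadingTerm M ν) (Set.Ioi 0) ∧
    (∃ S : ℝ, Tendsto (D.leadingTerm M ν) atTop (𝓝 S)) ∧
    -- if the precoder subspace is computed from the null space of the cross channel, then the
    -- Wishart eigenvalue and the quantization error in the leading term are independent
    ((∃ φ : Matrix (Fin L) (Fin L) ℂ → Matrix (Fin L) (Fin L) ℂ, Measurable φ ∧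
        ∀ X, D.innerPre X * (D.innerPre X)ᴴ = φ (D.nullProj X)) →
      IndepFun (fun X => CoopFeedback.gramEig X (K - Ne + 1)) D.err
        (CoopFeedback.cnMatrix K L)) := by
  subst hK
  have hK0 : 0 < K := by omega
  have hNp : 0 < Np := by omega
  have hKL : K ≤ L := by omega
  have hidx : K - K + 1 = 1 := by omega
  rw [hidx]
  refine ⟨?_, fun τ hτ => ⟨fun Pmax hP m ℓ _ => ?_, fun ℓ _ => ?_, ?_⟩, ?_, ?_, ?_⟩
  · rw [ae_all_iff]
    intro n
    have hl := D.hasLaw_effChannel hlaw hindep n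
    have h := hl.map_eq ▸ Measure.quasiMeasurePreserving_snd.ae
      (D.ae_gramEig_pos_and_err_pos hK0 hNp)
    exact ae_of_ae_map hl.aemeasurable h
  · have hl := D.hasLaw_effChannel hlaw hindep m
    have h := D.integrable_cappedRate hK0 hNp hτ.le hν0.le hP.le ℓ
    rw [← hl.map_eq] at h
    simp only [CoopFeedback.Design.rate_eq_cappedRate]
    exact h.comp_aemeasurable hl.aemeasurable
  · rw [D.limitRate_eq_scaledRate]
    exact D.integrable_scaledRate hK0 hNp (by positivity) ℓ
  · rw [isLittleO_one_iff]
    have h : Tendsto (fun Pmax => D.throughput P H M τ ν Pmax) atTop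
        (𝓝 (D.leadingTerm M ν τ)) := by
      simp only [D.throughput_eq hlaw hindep, D.leadingTerm_eq]
      exact (tendsto_finsetSum _ fun ℓ _ =>
        D.tendsto_integral_cappedRate hK0 hNp hτ.le hν0.le ℓ).const_mul 2
    simpa using h.sub_const (D.leadingTerm M ν τ)
  · intro τ hτ σ hσ hlt
    rw [Set.mem_Ioi] at hτ hσ
    have hc := CoopFeedback.Design.div_one_add_mul_lt hν0 hτ hlt
    have hc0 : 0 ≤ τ / ((1 + τ) * ν) := by positivity
    rw [D.leadingTerm_eq, D.leadingTerm_eq]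
    -- One strictly increasing summand suffices; `1 ≤ M` provides the stream `ℓ = 1`, whose gain is
    -- almost surely positive.
    refine mul_lt_mul_of_pos_left (Finset.sum_lt_sum
      (fun ℓ _ => D.integral_scaledRate_mono hK0 hNp hc0 hc.le ℓ)
      ⟨1, Finset.mem_Icc.2 ⟨le_rfl, hM⟩, D.integral_scaledRate_one_lt hK0 hNp hc0 hc⟩) two_pos
  -- `1 / ν` is the limit of `τ / ((1 + τ) * ν)`, and the rate with this coefficient is still
  -- integrable.
  · refine ⟨2 * ∑ ℓ ∈ Finset.Icc 1 M, ∫ X, D.scaledRate (1 / ν) ℓ X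
      ∂(CoopFeedback.cnMatrix K Np).prod (CoopFeedback.cnMatrix K L), ?_⟩
    have h : D.leadingTerm M ν = fun τ => 2 * ∑ ℓ ∈ Finset.Icc 1 M, ∫ X,
        D.scaledRate (τ / ((1 + τ) * ν)) ℓ X
          ∂(CoopFeedback.cnMatrix K Np).prod (CoopFeedback.cnMatrix K L) :=
      funext (D.leadingTerm_eq M ν)
    rw [h]
    exact (tendsto_finsetSum _ fun ℓ _ =>
      (D.tendsto_integral_scaledRate hK0 hNp ℓ (by positivity)).comp
        (CoopFeedback.Design.tendsto_div_one_add_mul hν0)).const_mul 2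
  · rintro ⟨φ, hφ, h⟩
    exact D.indepFun_gramEig_err hKL hφ h
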